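/- Let $k$ be a field and let $(X,<)$ be a well-ordered set, each letter $x$ of which has a parity $|x|\in\mathbb Z/2$ and a degree $\deg x\in\mathbb Z_{>0}$. Let $kX^{**}$ be the free non-associative $k$-algebra on $X$, with basis the set $X^{**}$ of bracketed terms, the parity of a term being the sum of the parities of its letters. The free Leibniz superalgebra $\mathrm{Lbs}(X)$ is the quotient of $kX^{**}$ by the ideal generated by all $(\mu(\nu\tau))-((\mu\nu)\tau)+(-1)^{|\nu||\tau|}((\mu\tau)\nu)$ with $\mu,\nu,\tau\in X^{**}$. The left-normed words $[a_1\cdots a_n]_L=((\cdots(a_1a_2)\cdots)a_n)$ with $n\ge1$, $a_i\in X$, form a linear basis $\mathrm{NF}(X)$ of $\mathrm{Lbs}(X)$. Order $\mathrm{NF}(X)$ by comparing $(\sum_i\deg a_i,\;n,\;a_1,\dots,a_n)$ lexicographically. For $f\ne0$ in $\mathrm{Lbs}(X)$, let $\mathrm{supp}(f)$ be the set of words of $\mathrm{NF}(X)$ occurring in $f$, and let $\bar f$ be the largest of them (the leading monomial); $f$ is monic if $\bar f$ has coefficient $1$, and homogeneous if all words in $\mathrm{supp}(f)$ have the same parity.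 For $S\subseteq\mathrm{Lbs}(X)$ put $\bar S=\{\bar s\mid s\in S\}$ and $\mathrm{Lbs}(X|S)=\mathrm{Lbs}(X)/\mathrm{Id}(S)$, where $\mathrm{Id}(S)$ is the ideal generated by $S$. Let $S$ be a (possibly empty) set of monic homogeneous elements. A normal $S$-polynomial $h_s$ $(s\in S)$ is an element $[s a_1\cdots a_m]_L$ with $m\ge0$ and $a_i\in X$, or, if $\bar s$ is a single letter, an element $[a_1\cdots a_t\,s\,a_{t+1}\cdots a_m]_L$ with $1\le t\le m$. Let $\mathrm{Irr}(S)$ be the set of words in $\mathrm{NF}(X)$ that are not the leading monomial of any normal $S$-polynomial. The set $S$ is a Gröbner–Shirshov basis in $\mathrm{Lbs}(X)$ if * for all $f\in S$ with $\bar f$ of length $>1$ and all $\mu\in\mathrm{NF}(X)$ with $(\mu f)\neq 0$, the product $(\mu f)$ is a linear combination of normal $S$-polynomials whose leading monomials have degree $\le\deg\mu+\deg\bar f$; and * for all $f\ne g$ in $S$ and every normal polynomial $h_g$ with $\bar f=\overline{h_g}$, the element $f-h_g$ is a linear combination of normal $S$-polynomials with leading monomials $<\bar f$. It is reduced if moreover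 $\mathrm{supp}(s)\subseteq\mathrm{Irr}(S\setminus\{s\})$ for all $s\in S$. **Proposition.** Let $R$ be a reduced Gröbner–Shirshov basis in $\mathrm{Lbs}(X)$, let $S=\{g\in R\mid \bar g\text{ has length }1\}$, $R'=R\setminus S$ and $X'=X\setminus\bar S$, with the order, parities and degrees inherited from $X$. Then the homomorphism $\mathrm{Lbs}(X')\to\mathrm{Lbs}(X)$ induced by the inclusion $X'\subseteq X$ is injective and its image contains $R'$, so that $R'$ may be regarded as a subset of $\mathrm{Lbs}(X')$. Moreover $\mathrm{Lbs}(X|R)\cong\mathrm{Lbs}(X'|R')$ as superalgebras (by a parity-preserving isomorphism), $R'$ is a reduced Gröbner–Shirshov basis in $\mathrm{Lbs}(X')$, and the leading monomial of every element of $R'$ has length greater than $1$. -/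

import Mathlib

universe u v w

namespace LeibnizGS

noncomputable section

/-! ### Ideals and quotients of non-associative algebras -/

section Ideals

variable (k : Type v) {A : Type w} [Field k] [NonUnitalNonAssocRing A] [Module k A]

/-- A subspace of a (non-associative) algebra is a (two-sided) ideal. -/
def IsIdeal (p : Submodule k A) : Prop :=
  ∀ x : A, ∀ y ∈ p, x * y ∈ p ∧ y * x ∈ p

/-- The ideal `Id(S)` generated by `S`: the smallest subspace containing `S` that is an ideal. -/
def idealSpan (S : Set A) : Submodule k A :=
  sInf {p : Submodule k A | IsIdeal k p ∧ S ⊆ p}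

theorem isIdeal_idealSpan (S : Set A) : IsIdeal k (idealSpan k S) := by
  intro x y hy
  simp only [idealSpan, Submodule.mem_sInf, Set.mem_ofPred_eq] at hy ⊢
  exact ⟨fun p hp => (hp.1 x y (hy p hp)).1, fun p hp => (hp.1 x y (hy p hp)).2⟩

theorem subset_idealSpan (S : Set A) : S ⊆ idealSpan k S := by
  intro y hy
  simp only [idealSpan, SetLike.mem_coe, Submodule.mem_sInf, Set.mem_ofPred_eq]
  exact fun p hp => hp.2 hy

theorem idealSpan_le {S : Set A} {p : Submodule k A} (hp : IsIdeal k p) (hS : S ⊆ p) :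
    idealSpan k S ≤ p :=
  sInf_le ⟨hp, hS⟩

/-- The quotient algebra `A / Id(S)`. -/
def QuotAlg (S : Set A) : Type w := A ⧸ idealSpan k S

namespace QuotAlg

variable (S : Set A)

instance : AddCommGroup (QuotAlg k S) := inferInstanceAs (AddCommGroup (A ⧸ idealSpan k S))

instance : Module k (QuotAlg k S) := inferInstanceAs (Module k (A ⧸ idealSpan k S))

/-- The canonical projection `A → A / Id(S)`. -/
def mk : A →ₗ[k] QuotAlg k S := (idealSpan k S).mkQ

variable {S}

theorem mk_surjective : Function.Surjective (mk k S) := Submodule.mkQ_surjective _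

theorem mk_eq_mk {x y : A} : mk k S x = mk k S y ↔ x - y ∈ idealSpan k S :=
  Submodule.Quotient.eq _

theorem mk_eq_zero {x : A} : mk k S x = 0 ↔ x ∈ idealSpan k S :=
  Submodule.Quotient.mk_eq_zero _

instance : Mul (QuotAlg k S) where
  mul := Quotient.map₂ (· * ·) (by
    intro a b hab c d hcd
    have h1 : a - b ∈ idealSpan k S := (Submodule.quotientRel_def _).1 hab
    have h2 : c - d ∈ idealSpan k S := (Submodule.quotientRel_def _).1 hcd
    refine (Submodule.quotientRel_def _).2 ?_
    have h3 := (isIdeal_idealSpan k S c _ h1).2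
    have h4 := (isIdeal_idealSpan k S b _ h2).1
    have h5 : a * c - b * d = (a - b) * c + b * (c - d) := by
      rw [sub_mul, mul_sub]; abel
    rw [h5]
    exact add_mem h3 h4)

theorem mk_mul (x y : A) : mk k S (x * y) = mk k S x * mk k S y := rfl

instance : NonUnitalNonAssocRing (QuotAlg k S) where
  left_distrib := by
    intro a b c
    obtain ⟨a, rfl⟩ := mk_surjective k a
    obtain ⟨b, rfl⟩ := mk_surjective k b
    obtain ⟨c, rfl⟩ := mk_surjective k c
    simp only [← map_add, ← mk_mul, mul_add]
  right_distrib := by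
    intro a b c
    obtain ⟨a, rfl⟩ := mk_surjective k a
    obtain ⟨b, rfl⟩ := mk_surjective k b
    obtain ⟨c, rfl⟩ := mk_surjective k c
    simp only [← map_add, ← mk_mul, add_mul]
  zero_mul := by
    intro a
    obtain ⟨a, rfl⟩ := mk_surjective k a
    rw [← map_zero (mk k S), ← mk_mul, zero_mul]
  mul_zero := by
    intro a
    obtain ⟨a, rfl⟩ := mk_surjective k a
    rw [← map_zero (mk k S), ← mk_mul, mul_zero]

instance [IsScalarTower k A A] : IsScalarTower k (QuotAlg k S) (QuotAlg k S) where
  smul_assoc := by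
    intro r a b
    obtain ⟨a, rfl⟩ := mk_surjective k a
    obtain ⟨b, rfl⟩ := mk_surjective k b
    simp only [smul_eq_mul, ← map_smul, ← mk_mul, smul_mul_assoc]

instance [SMulCommClass k A A] : SMulCommClass k (QuotAlg k S) (QuotAlg k S) where
  smul_comm := by
    intro r a b
    obtain ⟨a, rfl⟩ := mk_surjective k a
    obtain ⟨b, rfl⟩ := mk_surjective k b
    simp only [smul_eq_mul, ← map_smul, ← mk_mul, mul_smul_comm]

end QuotAlg

/-- Two algebras with `ℤ/2`-gradings are isomorphic as superalgebras: there is a bijective linear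
multiplicative map which, together with its inverse, preserves parity. -/
def SuperIso {B : Type*} [NonUnitalNonAssocRing B] [Module k B]
    (𝒜 : ZMod 2 → Submodule k A) (ℬ : ZMod 2 → Submodule k B) : Prop :=
  ∃ e : A ≃ₗ[k] B, (∀ x y, e (x * y) = e x * e y) ∧ ∀ i x, e x ∈ ℬ i ↔ x ∈ 𝒜 i

end Ideals

/-! ### The free Leibniz superalgebra -/

section Free

variable (k : Type v) [Field k] {X : Type u} (par : X → ZMod 2)

/-- The sign `(-1)^{ij}`. -/
def superSign (i j : ZMod 2) : k := (-1) ^ (i.val * j.val)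

/-- The parity of a term, given the parities of the letters. -/
def termParity : FreeMagma X → ZMod 2
  | .of x => par x
  | .mul μ ν => termParity μ + termParity ν

@[simp] theorem termParity_of (x : X) : termParity par (.of x) = par x := rfl

@[simp] theorem termParity_mul (μ ν : FreeMagma X) :
    termParity par (μ * ν) = termParity par μ + termParity par ν := rfl

/-- A term, as an element of the free non-associative algebra `kX**`. -/
def monom (μ : FreeMagma X) : FreeNonUnitalNonAssocAlgebra k X := MonoidAlgebra.ofMagma k _ μ

theorem monom_mul (μ ν : FreeMagma X) : monom k (μ * ν) = monom k μ * monom k ν :=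
  map_mul (MonoidAlgebra.ofMagma k _) μ ν

/-- The elements `(μ(ντ)) - ((μν)τ) + (-1)^{|ν||τ|} ((μτ)ν)` of `kX**`. -/
def leibnizRel : Set (FreeNonUnitalNonAssocAlgebra k X) :=
  {r | ∃ μ ν τ : FreeMagma X,
    r = monom k (μ * (ν * τ)) - monom k ((μ * ν) * τ)
      + superSign k (termParity par ν) (termParity par τ) • monom k ((μ * τ) * ν)}

/-- The free Leibniz superalgebra `Lbs(X)` generated by `X`, where the letter `x` has parity
`par x`. -/
abbrev Lbs : Type _ := QuotAlg k (leibnizRel k par)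

/-- The homogeneous component of parity `i` of `Lbs(X)`. -/
def Lbs.grade (i : ZMod 2) : Submodule k (Lbs k par) :=
  Submodule.map (QuotAlg.mk k (leibnizRel k par))
    (Submodule.span k {p | ∃ μ : FreeMagma X, termParity par μ = i ∧ p = monom k μ})

/-- The presented Leibniz superalgebra `Lbs(X | S) = Lbs(X) / Id(S)`. -/
abbrev Presented (S : Set (Lbs k par)) : Type _ := QuotAlg k S

/-- The homogeneous component of parity `i` of `Lbs(X | S)`. -/
def Presented.grade (S : Set (Lbs k par)) (i : ZMod 2) : Submodule k (Presented k par S) :=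
  Submodule.map (QuotAlg.mk k S) (Lbs.grade k par i)

/-- The left-normed term `[a₁ ⋯ aₙ]_L`. -/
def leftTerm (w : FreeSemigroup X) : FreeMagma X :=
  w.tail.foldl (fun t a => t * .of a) (.of w.head)

/-- The parity of a nonempty word, i.e. of the term `[a₁ ⋯ aₙ]_L`. -/
def wordParity (w : FreeSemigroup X) : ZMod 2 := termParity par (leftTerm w)

/-- The class of a term in `Lbs(X)`. -/
def Lbs.ofTerm (μ : FreeMagma X) : Lbs k par := QuotAlg.mk k _ (monom k μ)

/-- The class of a letter in `Lbs(X)`. -/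
def Lbs.of (x : X) : Lbs k par := Lbs.ofTerm k par (.of x)

/-- The element `[a₁ ⋯ aₙ]_L` of `NF(X) ⊆ Lbs(X)`. -/
def Lbs.nf (w : FreeSemigroup X) : Lbs k par := Lbs.ofTerm k par (leftTerm w)

end Free

/-! ### The normal forms are a linear basis of `Lbs(X)` -/

section Basis

variable (k : Type v) [Field k] {X : Type u} (par : X → ZMod 2)

theorem word_snoc_induction {P : FreeSemigroup X → Prop} (h1 : ∀ a, P (.of a))
    (h2 : ∀ w a, P w → P (w * .of a)) (w : FreeSemigroup X) : P w := by
  obtain ⟨h, t⟩ := w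
  induction t using List.reverseRecOn with
  | nil => exact h1 h
  | append_singleton l a ih => exact h2 _ a ih

@[simp] theorem leftTerm_of (a : X) : leftTerm (.of a) = FreeMagma.of a := rfl

@[simp] theorem leftTerm_snoc (w : FreeSemigroup X) (a : X) :
    leftTerm (w * .of a) = leftTerm w * .of a := by
  simp [leftTerm]

@[simp] theorem wordParity_of (a : X) : wordParity par (.of a) = par a := rfl

@[simp] theorem wordParity_snoc (w : FreeSemigroup X) (a : X) :
    wordParity par (w * .of a) = wordParity par w + par a := by
  simp [wordParity]

/-- The space with basis the nonempty words. -/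
def WordSpace (k : Type v) [Field k] (X : Type u) : Type (max u v) := FreeSemigroup X →₀ k

instance : AddCommGroup (WordSpace k X) := inferInstanceAs (AddCommGroup (FreeSemigroup X →₀ k))

instance : Module k (WordSpace k X) := inferInstanceAs (Module k (FreeSemigroup X →₀ k))

/-- The basis of words. -/
def word : Module.Basis (FreeSemigroup X) k (WordSpace k X) :=
  Module.Basis.ofRepr (LinearEquiv.refl k (FreeSemigroup X →₀ k))

/-- Appending a letter. -/
def app (a : X) : Module.End k (WordSpace k X) :=
  (word k).constr k (fun w => word k (w * .of a))

/-- Right multiplication by a word in the word model of the free Leibniz superalgebra. -/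
def op (w : FreeSemigroup X) : Module.End k (WordSpace k X) :=
  (w.tail.foldl (fun (p : Module.End k (WordSpace k X) × ZMod 2) a =>
    (app k a * p.1 - superSign k p.2 (par a) • (p.1 * app k a), p.2 + par a))
    (app k w.head, par w.head)).1

theorem op_snd (w : FreeSemigroup X) :
    (w.tail.foldl (fun (p : Module.End k (WordSpace k X) × ZMod 2) a =>
    (app k a * p.1 - superSign k p.2 (par a) • (p.1 * app k a), p.2 + par a))
    (app k w.head, par w.head)).2 = wordParity par w := by
  induction w using word_snoc_induction with
  | h1 a => rfl
  | h2 w a ih =>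
    rw [wordParity_snoc, ← ih]
    simp

theorem op_of (a : X) : op k par (.of a) = app k a := rfl

theorem op_snoc (w : FreeSemigroup X) (a : X) :
    op k par (w * .of a) = app k a * op k par w
      - superSign k (wordParity par w) (par a) • (op k par w * app k a) := by
  rw [← op_snd k par w]
  simp [op]

/-- Right multiplication in the word model, extended linearly. -/
def opL : WordSpace k X →ₗ[k] Module.End k (WordSpace k X) :=
  (word k).constr k (op k par)

theorem opL_single (w : FreeSemigroup X) : opL k par (word k w) = op k par w := by
  simp [opL]

theorem app_single (a : X) (w : FreeSemigroup X) :
    app k a (word k w) = word k (w * .of a) := by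
  simp [app]

/-- The span of the words of a given parity. -/
def hom (i : ZMod 2) : Submodule k (WordSpace k X) :=
  Submodule.span k {p | ∃ w, wordParity par w = i ∧ p = word k w}

theorem app_hom (a : X) (i : ZMod 2) (x : WordSpace k X) (hx : x ∈ hom k par i) :
    app k a x ∈ hom k par (i + par a) := by
  refine Submodule.span_induction ?_ (by simp) (fun x y _ _ h1 h2 => by
    rw [map_add]; exact add_mem h1 h2) (fun r x _ h => by
    rw [map_smul]; exact Submodule.smul_mem _ _ h) hx
  rintro _ ⟨w, rfl, rfl⟩
  rw [app_single]
  exact Submodule.subset_span ⟨_, wordParity_snoc par w a, rfl⟩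

theorem op_hom (w : FreeSemigroup X) : ∀ (i : ZMod 2) (x : WordSpace k X), x ∈ hom k par i →
    op k par w x ∈ hom k par (i + wordParity par w) := by
  induction w using word_snoc_induction with
  | h1 a => exact app_hom k par a
  | h2 w a ih =>
    intro i x hx
    rw [op_snoc, wordParity_snoc]
    simp only [LinearMap.sub_apply, LinearMap.smul_apply, Module.End.mul_apply]
    have h1 := app_hom k par a _ _ (ih i x hx)
    have h2 := ih _ _ (app_hom k par a i x hx)
    rw [add_assoc] at h1
    rw [add_assoc, add_comm (par a)] at h2
    exact sub_mem h1 (Submodule.smul_mem _ _ h2)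

theorem opL_app (a : X) (i : ZMod 2) (x : WordSpace k X) (hx : x ∈ hom k par i) :
    opL k par (app k a x) = app k a * opL k par x
      - superSign k i (par a) • (opL k par x * app k a) := by
  refine Submodule.span_induction ?_ (by simp) (fun x y _ _ h1 h2 => by
    simp only [map_add, h1, h2, mul_add, add_mul, smul_add]; abel) (fun r x _ h => by
    simp only [map_smul, h, mul_smul_comm, smul_mul_assoc, smul_sub, smul_comm r]) hx
  rintro _ ⟨w, rfl, rfl⟩
  rw [app_single, opL_single, opL_single, op_snoc]

theorem opL_op (z : FreeSemigroup X) : ∀ y : FreeSemigroup X,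
    opL k par (op k par z (word k y)) = op k par z * op k par y
      - superSign k (wordParity par y) (wordParity par z) • (op k par y * op k par z) := by
  induction z using word_snoc_induction with
  | h1 a =>
    intro y
    rw [op_of, app_single, opL_single, op_snoc, wordParity_of]
  | h2 z a ih =>
    intro y
    have hy : op k par z (word k y) ∈ hom k par (wordParity par y + wordParity par z) :=
      op_hom k par z _ _ (Submodule.subset_span ⟨y, rfl, rfl⟩)
    conv_lhs =>
      rw [op_snoc]
      simp only [LinearMap.sub_apply, LinearMap.smul_apply, Module.End.mul_apply, map_sub,
        map_smul]
      rw [opL_app k par a _ _ hy, ih, app_single, ih]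
    rw [op_snoc k par y a, op_snoc k par z a, wordParity_snoc, wordParity_snoc]
    generalize wordParity par y = p
    generalize wordParity par z = q
    generalize par a = r
    generalize op k par y = Y
    generalize op k par z = Z
    generalize app k a = A
    have h01 : ∀ i : ZMod 2, i = 0 ∨ i = 1 := by decide
    have h11 : (1 : ZMod 2) + 1 = 0 := by decide
    have s11 : superSign k 1 1 = -1 := by simp [superSign, ZMod.val_one]
    have s01 : superSign k 0 1 = 1 := by simp [superSign]
    have s10 : superSign k 1 0 = 1 := by simp [superSign]
    have s00 : superSign k 0 0 = 1 := by simp [superSign]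
    rcases h01 p with rfl | rfl <;> rcases h01 q with rfl | rfl <;> rcases h01 r with rfl | rfl <;>
      simp only [h11, add_zero, zero_add, s11, s01, s10, s00, one_smul, neg_smul] <;>
      noncomm_ring

/-- The product of the word model: `x * y = opL y x`. -/
theorem opL_leibniz (p q : ZMod 2) (y z : WordSpace k X) (hy : y ∈ hom k par p)
    (hz : z ∈ hom k par q) :
    opL k par (opL k par z y) = opL k par z * opL k par y
      - superSign k p q • (opL k par y * opL k par z) := by
  refine Submodule.span_induction ?_ (by simp) (fun x y _ _ h1 h2 => by
    simp only [map_add, LinearMap.add_apply, h1, h2, mul_add, add_mul, smul_add]; abel)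
    (fun r x _ h => by
    simp only [map_smul, LinearMap.smul_apply, h, mul_smul_comm, smul_mul_assoc, smul_sub,
      smul_comm r]) hz
  rintro _ ⟨w, rfl, rfl⟩
  refine Submodule.span_induction ?_ (by simp) (fun x y _ _ h1 h2 => by
    simp only [map_add, h1, h2, mul_add, add_mul, smul_add]; abel)
    (fun r x _ h => by
    simp only [map_smul, h, mul_smul_comm, smul_mul_assoc, smul_sub, smul_comm r]) hy
  rintro _ ⟨y, rfl, rfl⟩
  rw [opL_single, opL_single, opL_op]

/-- Evaluation of a term in the word model. -/
def evTerm : FreeMagma X → WordSpace k X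
  | .of x => word k (.of x)
  | .mul μ ν => opL k par (evTerm ν) (evTerm μ)

theorem evTerm_mul (μ ν : FreeMagma X) :
    evTerm k par (μ * ν) = opL k par (evTerm k par ν) (evTerm k par μ) := rfl

theorem opL_hom (p q : ZMod 2) (y z : WordSpace k X) (hy : y ∈ hom k par p)
    (hz : z ∈ hom k par q) : opL k par z y ∈ hom k par (p + q) := by
  refine Submodule.span_induction ?_ (by simp) (fun x y _ _ h1 h2 => by
    rw [map_add]; exact add_mem h1 h2) (fun r x _ h => by
    rw [map_smul]; exact Submodule.smul_mem _ _ h) hz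
  rintro _ ⟨w, rfl, rfl⟩
  rw [opL_single]
  exact op_hom k par w p y hy

theorem evTerm_hom (μ : FreeMagma X) : evTerm k par μ ∈ hom k par (termParity par μ) := by
  induction μ with
  | ih1 x => exact Submodule.subset_span ⟨.of x, rfl, rfl⟩
  | ih2 μ ν h1 h2 => exact opL_hom k par _ _ _ _ h1 h2

/-- Evaluation of a polynomial in the word model. -/
def evPoly : FreeNonUnitalNonAssocAlgebra k X →ₗ[k] WordSpace k X :=
  Finsupp.linearCombination k (evTerm k par) ∘ₗ
    (MonoidAlgebra.coeffLinearEquiv k).toLinearMap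

theorem evPoly_monom (μ : FreeMagma X) : evPoly k par (monom k μ) = evTerm k par μ := by
  simp [evPoly, monom]

theorem monom_span (x : FreeNonUnitalNonAssocAlgebra k X) :
    x ∈ Submodule.span k (Set.range (monom k (X := X))) := by
  induction x using MonoidAlgebra.induction_linear with
  | zero => exact zero_mem _
  | add f g h1 h2 => exact add_mem h1 h2
  | single μ r =>
    have : MonoidAlgebra.single μ r = r • monom k μ := by simp [monom]
    rw [this]
    exact Submodule.smul_mem _ _ (Submodule.subset_span ⟨μ, rfl⟩)

theorem evPoly_mul (x y : FreeNonUnitalNonAssocAlgebra k X) :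
    evPoly k par (x * y) = opL k par (evPoly k par y) (evPoly k par x) := by
  refine Submodule.span_induction ?_ (by simp) (fun a b _ _ h1 h2 => by
    simp only [add_mul, map_add, h1, h2]) (fun r a _ h => by
    simp only [smul_mul_assoc, map_smul, h]) (monom_span k x)
  rintro _ ⟨μ, rfl⟩
  refine Submodule.span_induction ?_ (by simp) (fun a b _ _ h1 h2 => by
    simp only [mul_add, map_add, LinearMap.add_apply, h1, h2]) (fun r a _ h => by
    simp only [mul_smul_comm, map_smul, LinearMap.smul_apply, h]) (monom_span k y)
  rintro _ ⟨ν, rfl⟩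
  rw [← monom_mul, evPoly_monom, evPoly_monom, evPoly_monom, evTerm_mul]

theorem idealSpan_le_ker : idealSpan k (leibnizRel k par) ≤ LinearMap.ker (evPoly k par) := by
  refine idealSpan_le k ?_ ?_
  · intro x y hy
    rw [LinearMap.mem_ker] at hy
    simp [LinearMap.mem_ker, evPoly_mul, hy]
  · rintro _ ⟨μ, ν, τ, rfl⟩
    have := opL_leibniz k par _ _ _ _ (evTerm_hom k par ν) (evTerm_hom k par τ)
    simp [evPoly_monom, evTerm_mul, this]

/-- The coordinates of an element of `Lbs(X)`. -/
def evLbs : Lbs k par →ₗ[k] WordSpace k X :=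
  (idealSpan k (leibnizRel k par)).liftQ (evPoly k par) (idealSpan_le_ker k par)

theorem evLbs_nf (w : FreeSemigroup X) :
    evLbs k par (Lbs.nf k par w) = word k w := by
  have h : evLbs k par (Lbs.nf k par w) = evTerm k par (leftTerm w) :=
    (Submodule.liftQ_apply _ _ _).trans (evPoly_monom k par _)
  rw [h]
  induction w using word_snoc_induction with
  | h1 a => rfl
  | h2 w a ih =>
    rw [leftTerm_snoc, evTerm_mul, ih (by
      exact (Submodule.liftQ_apply _ _ _).trans (evPoly_monom k par _))]
    change opL k par (word k (.of a)) _ = _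
    rw [opL_single, op_of, app_single]

theorem nf_linearIndependent : LinearIndependent k (Lbs.nf k par) := by
  refine LinearIndependent.of_comp (evLbs k par) ?_
  have : (evLbs k par) ∘ (Lbs.nf k par) = word k :=
    funext (evLbs_nf k par)
  rw [this]
  exact (word k).linearIndependent

theorem ofTerm_mul (μ ν : FreeMagma X) :
    Lbs.ofTerm k par (μ * ν) = Lbs.ofTerm k par μ * Lbs.ofTerm k par ν := by
  rw [Lbs.ofTerm, monom_mul, QuotAlg.mk_mul]; rfl

theorem nf_of (a : X) : Lbs.nf k par (.of a) = Lbs.of k par a := rfl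

theorem nf_snoc (w : FreeSemigroup X) (a : X) :
    Lbs.nf k par (w * .of a) = Lbs.nf k par w * Lbs.of k par a := by
  rw [Lbs.nf, leftTerm_snoc, ofTerm_mul]; rfl

theorem ofTerm_leibniz (μ ν τ : FreeMagma X) :
    Lbs.ofTerm k par μ * (Lbs.ofTerm k par ν * Lbs.ofTerm k par τ)
      = Lbs.ofTerm k par μ * Lbs.ofTerm k par ν * Lbs.ofTerm k par τ
        - superSign k (termParity par ν) (termParity par τ) •
          (Lbs.ofTerm k par μ * Lbs.ofTerm k par τ * Lbs.ofTerm k par ν) := by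
  have h : QuotAlg.mk k (leibnizRel k par) (monom k (μ * (ν * τ)) - monom k ((μ * ν) * τ)
      + superSign k (termParity par ν) (termParity par τ) • monom k ((μ * τ) * ν)) = 0 :=
    (QuotAlg.mk_eq_zero k).2 (subset_idealSpan k _ ⟨μ, ν, τ, rfl⟩)
  rw [map_add, map_sub, map_smul] at h
  change Lbs.ofTerm k par _ - Lbs.ofTerm k par _ + _ • Lbs.ofTerm k par _ = 0 at h
  simp only [ofTerm_mul] at h
  rw [← sub_eq_zero, ← h]
  abel

theorem span_mul_nf (w : FreeSemigroup X) : ∀ μ : FreeMagma X,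
    Lbs.ofTerm k par μ ∈ Submodule.span k (Set.range (Lbs.nf k par)) →
    Lbs.ofTerm k par μ * Lbs.nf k par w ∈ Submodule.span k (Set.range (Lbs.nf k par)) := by
  suffices H : ∀ x ∈ Submodule.span k (Set.range (Lbs.nf k par)),
      x * Lbs.nf k par w ∈ Submodule.span k (Set.range (Lbs.nf k par)) from fun μ hμ => H _ hμ
  induction w using word_snoc_induction with
  | h1 a =>
    intro x hx
    refine Submodule.span_induction ?_ (by simp) (fun a b _ _ h1 h2 => by
      rw [add_mul]; exact add_mem h1 h2) (fun r a _ h => by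
      rw [smul_mul_assoc]; exact Submodule.smul_mem _ _ h) hx
    rintro _ ⟨v, rfl⟩
    rw [nf_of, ← nf_snoc]
    exact Submodule.subset_span ⟨_, rfl⟩
  | h2 w a ih =>
    have hL : ∀ x ∈ Submodule.span k (Set.range (Lbs.nf k par)),
        x * Lbs.of k par a ∈ Submodule.span k (Set.range (Lbs.nf k par)) := by
      intro x hx
      refine Submodule.span_induction ?_ (by simp) (fun a b _ _ h1 h2 => by
        rw [add_mul]; exact add_mem h1 h2) (fun r a _ h => by
        rw [smul_mul_assoc]; exact Submodule.smul_mem _ _ h) hx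
      rintro _ ⟨v, rfl⟩
      rw [← nf_snoc]
      exact Submodule.subset_span ⟨_, rfl⟩
    intro x hx
    refine Submodule.span_induction ?_ (by simp) (fun a b _ _ h1 h2 => by
      rw [add_mul]; exact add_mem h1 h2) (fun r a _ h => by
      rw [smul_mul_assoc]; exact Submodule.smul_mem _ _ h) hx
    rintro _ ⟨v, rfl⟩
    rw [nf_snoc]
    have h := ofTerm_leibniz k par (leftTerm v) (leftTerm w) (.of a)
    change Lbs.nf k par v * (Lbs.nf k par w * Lbs.of k par a) = _ at h
    rw [h]
    refine sub_mem (hL _ (ih _ (Submodule.subset_span ⟨v, rfl⟩))) (Submodule.smul_mem _ _ ?_)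
    exact ih _ (hL _ (Submodule.subset_span ⟨v, rfl⟩))

theorem ofTerm_mem_span (μ : FreeMagma X) :
    Lbs.ofTerm k par μ ∈ Submodule.span k (Set.range (Lbs.nf k par)) := by
  induction μ with
  | ih1 x => exact Submodule.subset_span ⟨.of x, rfl⟩
  | ih2 μ ν h1 h2 =>
    rw [ofTerm_mul]
    refine Submodule.span_induction (p := fun y _ => Lbs.ofTerm k par μ * y ∈ _)
      ?_ (by simp) (fun a b _ _ h1 h2 => by
      rw [mul_add]; exact add_mem h1 h2) (fun r a _ h => by
      rw [mul_smul_comm]; exact Submodule.smul_mem _ _ h) h2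
    rintro _ ⟨w, rfl⟩
    exact span_mul_nf k par w μ h1

theorem nf_span : ⊤ ≤ Submodule.span k (Set.range (Lbs.nf k par)) := by
  intro x _
  obtain ⟨x, rfl⟩ := QuotAlg.mk_surjective k x
  refine Submodule.span_induction
    (p := fun y _ => QuotAlg.mk k (leibnizRel k par) y ∈ _) ?_ (by simp) (fun a b _ _ h1 h2 => by
      rw [map_add]; exact add_mem h1 h2) (fun r a _ h => by
      rw [map_smul]; exact Submodule.smul_mem _ _ h) (monom_span k x)
  rintro _ ⟨μ, rfl⟩
  exact ofTerm_mem_span k par μ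

/-- The set `NF(X)` of left-normed words `[a₁ ⋯ aₙ]_L`, as a linear basis of `Lbs(X)`. -/
def Lbs.nfBasis : Module.Basis (FreeSemigroup X) k (Lbs k par) :=
  Module.Basis.mk (nf_linearIndependent k par) (nf_span k par)

@[simp] theorem Lbs.nfBasis_apply (w : FreeSemigroup X) :
    Lbs.nfBasis k par w = Lbs.nf k par w := by
  simp [Lbs.nfBasis]

end Basis

/-! ### The homomorphism of free Leibniz superalgebras induced by a map of letters -/

section Map

variable (k : Type v) [Field k] {X Y : Type u} (par : X → ZMod 2) (f : Y → X)

/-- The induced homomorphism `kY** → Lbs(X)`. -/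
def Lbs.preMap : FreeNonUnitalNonAssocAlgebra k Y →ₙₐ[k] Lbs k par :=
  FreeNonUnitalNonAssocAlgebra.lift k (fun y => Lbs.of k par (f y))

theorem preMap_monom (μ : FreeMagma Y) :
    Lbs.preMap k par f (monom k μ) = Lbs.ofTerm k par (FreeMagma.map f μ) := by
  induction μ with
  | ih1 y => exact FreeNonUnitalNonAssocAlgebra.lift_of_apply k _ y
  | ih2 μ ν h1 h2 => rw [monom_mul, map_mul, h1, h2, map_mul, ofTerm_mul]

theorem termParity_map (μ : FreeMagma Y) :
    termParity par (FreeMagma.map f μ) = termParity (par ∘ f) μ := by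
  induction μ with
  | ih1 y => rfl
  | ih2 μ ν h1 h2 => rw [map_mul, termParity_mul, termParity_mul, h1, h2]

theorem idealSpan_le_ker_preMap : idealSpan k (leibnizRel k (par ∘ f)) ≤
    LinearMap.ker (Lbs.preMap k par f : FreeNonUnitalNonAssocAlgebra k Y →ₗ[k] Lbs k par) := by
  refine idealSpan_le k ?_ ?_
  · intro x y hy
    have hy' : Lbs.preMap k par f y = 0 := hy
    constructor
    · change Lbs.preMap k par f (x * y) = 0
      rw [map_mul, hy', mul_zero]
    · change Lbs.preMap k par f (y * x) = 0
      rw [map_mul, hy', zero_mul]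
  · rintro _ ⟨μ, ν, τ, rfl⟩
    change Lbs.preMap k par f _ = 0
    rw [map_add, map_sub, map_smul, preMap_monom, preMap_monom, preMap_monom]
    simp only [map_mul, ofTerm_mul, ofTerm_leibniz, termParity_map]
    abel

/-- The homomorphism `Lbs(Y) → Lbs(X)` that sends the letter `y` to the letter `f y`. -/
def Lbs.map : Lbs k (par ∘ f) →ₙₐ[k] Lbs k par where
  toFun := (idealSpan k (leibnizRel k (par ∘ f))).liftQ
    (Lbs.preMap k par f : FreeNonUnitalNonAssocAlgebra k Y →ₗ[k] Lbs k par)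
    (idealSpan_le_ker_preMap k par f)
  map_smul' r x := map_smul _ r x
  map_zero' := map_zero _
  map_add' x y := map_add _ x y
  map_mul' x y := by
    obtain ⟨x, rfl⟩ := QuotAlg.mk_surjective k x
    obtain ⟨y, rfl⟩ := QuotAlg.mk_surjective k y
    exact map_mul (Lbs.preMap k par f) x y

theorem Lbs.map_of (y : Y) : Lbs.map k par f (Lbs.of k (par ∘ f) y) = Lbs.of k par (f y) :=
  preMap_monom k par f (.of y)

end Map

/-! ### Gröbner–Shirshov bases -/

section GS

variable {k : Type v} [Field k] {X : Type u} [LinearOrder X] {par : X → ZMod 2} (deg : X → ℕ)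

/-- The degree of a word. -/
def wordDeg (w : FreeSemigroup X) : ℕ := deg w.head + (w.tail.map deg).sum

/-- The deg-length-lex order on nonempty words (equivalently, on `NF(X)`). -/
def WordLT (μ ν : FreeSemigroup X) : Prop :=
  wordDeg deg μ < wordDeg deg ν ∨
    (wordDeg deg μ = wordDeg deg ν ∧
      (μ.length < ν.length ∨
        (μ.length = ν.length ∧
          List.Lex (· < ·) (μ.head :: μ.tail) (ν.head :: ν.tail))))

/-- The support of `f ∈ Lbs(X)`: the words that occur in `f` with a nonzero coefficient. -/
def supp (f : Lbs k par) : Finset (FreeSemigroup X) := ((Lbs.nfBasis k par).repr f).support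

/-- `f ≠ 0` and `μ` is the leading monomial of `f`. -/
def IsLeading (f : Lbs k par) (μ : FreeSemigroup X) : Prop :=
  μ ∈ supp f ∧ ∀ ν ∈ supp f, ν ≠ μ → WordLT deg ν μ

/-- `f` is nonzero with leading coefficient `1`. -/
def IsMonic (f : Lbs k par) : Prop :=
  ∃ μ, IsLeading deg f μ ∧ (Lbs.nfBasis k par).repr f μ = 1

/-- `f` is homogeneous: all the words that occur in `f` have the same parity. -/
def IsHomogeneous (f : Lbs k par) : Prop :=
  ∃ i : ZMod 2, ∀ μ ∈ supp f, wordParity par μ = i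

/-- The element `[f a₁ ⋯ aₘ]_L`, where `a₁, …, aₘ` are letters and `m ≥ 0`. -/
def mulLetters (f : Lbs k par) (as : List X) : Lbs k par :=
  as.foldl (fun g a => g * Lbs.of k par a) f

/-- `IsNormalPoly deg s h`: `h` is a normal polynomial `h_s` built on `s`, that is
`h = [s a₁ ⋯ aₘ]_L`, or `h = [a₁ ⋯ aₜ s aₜ₊₁ ⋯ aₘ]_L` with `t ≥ 1` in case the leading monomial of
`s` has length `1`. -/
inductive IsNormalPoly (s : Lbs k par) : Lbs k par → Prop
  | right (as : List X) : IsNormalPoly s (mulLetters s as)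
  | mid (μ : FreeSemigroup X) (as : List X)
      (hs : ∃ x : X, IsLeading deg s (FreeSemigroup.of x)) :
      IsNormalPoly s (mulLetters (Lbs.nf k par μ * s) as)

/-- The set `Irr(S)` of words that are not the leading monomial of any normal `S`-polynomial. -/
def Irr (S : Set (Lbs k par)) : Set (FreeSemigroup X) :=
  {μ | ∀ s ∈ S, ∀ h, IsNormalPoly deg s h → ¬ IsLeading deg h μ}

/-- `h ≡ 0 mod (S, μ)`: `h` is a linear combination of normal `S`-polynomials with leading
monomials `< μ`. -/
def TrivialModWord (S : Set (Lbs k par)) (μ : FreeSemigroup X) (h : Lbs k par) : Prop :=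
  h ∈ Submodule.span k
    {p | ∃ s ∈ S, IsNormalPoly deg s p ∧ ∃ ν, IsLeading deg p ν ∧ WordLT deg ν μ}

/-- `h ≡ 0 mod (S, n)`: `h` is a linear combination of normal `S`-polynomials whose leading
monomials have degree `≤ n`. -/
def TrivialModDeg (S : Set (Lbs k par)) (n : ℕ) (h : Lbs k par) : Prop :=
  h ∈ Submodule.span k
    {p | ∃ s ∈ S, IsNormalPoly deg s p ∧ ∃ ν, IsLeading deg p ν ∧ wordDeg deg ν ≤ n}

/-- `S` is a Gröbner–Shirshov basis in `Lbs(X)` (the empty set is allowed): a monic homogeneous set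
all of whose left multiplication compositions `(μ f)` and inclusion compositions `f - h_g` are
trivial. -/
structure IsGSBasis (S : Set (Lbs k par)) : Prop where
  monic : ∀ f ∈ S, IsMonic deg f
  homogeneous : ∀ f ∈ S, IsHomogeneous f
  leftMul : ∀ f ∈ S, ∀ μ ν : FreeSemigroup X, IsLeading deg f ν → 1 < ν.length →
    Lbs.nf k par μ * f ≠ 0 →
      TrivialModDeg deg S (wordDeg deg μ + wordDeg deg ν) (Lbs.nf k par μ * f)
  inclusion : ∀ f ∈ S, ∀ g ∈ S, f ≠ g → ∀ h, IsNormalPoly deg g h →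
    ∀ ν : FreeSemigroup X, IsLeading deg f ν → IsLeading deg h ν → TrivialModWord deg S ν (f - h)

/-- `S` is a reduced Gröbner–Shirshov basis in `Lbs(X)`. -/
structure IsReducedGSBasis (S : Set (Lbs k par)) : Prop extends IsGSBasis deg S where
  reduced : ∀ s ∈ S, ∀ μ ∈ supp s, μ ∈ Irr deg (S \ {s})

/-- The elements of `R` whose leading monomial has length `1`. -/
def letterPart (R : Set (Lbs k par)) : Set (Lbs k par) :=
  {g ∈ R | ∃ μ, IsLeading deg g μ ∧ μ.length = 1}

/-- The set of letters `X' = X ∖ S̄`, where `S` is the set of elements of `R` whose leading monomial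
has length `1`. -/
def restLetters (R : Set (Lbs k par)) : Set X :=
  {x | ¬ ∃ g ∈ letterPart deg R, IsLeading deg g (FreeSemigroup.of x)}

/-- The homomorphism `Lbs(Y) → Lbs(X)` induced by the inclusion `Y ⊆ X`. -/
def Lbs.incl (k : Type v) [Field k] (par : X → ZMod 2) (Y : Set X) :
    Lbs k (par ∘ ((↑) : Y → X)) →ₙₐ[k] Lbs k par :=
  Lbs.map k par ((↑) : Y → X)

/-- `R' = R ∖ S` as a subset of `Lbs(X')`. -/
def restRel (R : Set (Lbs k par)) :
    Set (Lbs k (par ∘ ((↑) : restLetters deg R → X))) :=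
  Lbs.incl k par (restLetters deg R) ⁻¹' (R \ letterPart deg R)

end GS

end

end LeibnizGS

namespace LeibnizGS

noncomputable section

/-! ### Parity and the Leibniz identity in `Lbs(X)` -/

section Free

variable {k : Type v} [Field k] {X : Type u} {par : X → ZMod 2}

/-! The proof eliminates the letters outside `X'`. Each such letter `y` is the leading monomial of
some `g ∈ S`. Because that monomial is a single letter, `g` may stand at any place of a normal
polynomial, and every word containing `y` is then a leading monomial of some `h_g`
(`exists_isNormalPoly_of_mem`). Reducedness therefore bars `y` from the support of every element of
`R` other than `g`. In `g` itself, `y` occurs only as the leading word, since a word smaller than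
`y` cannot contain `y` (`eq_of_of_mem_supp`). So `R'` lies in `Lbs(X')`, and `g = y - p` with `p` in
`Lbs(X')`.

Substituting `p` for `y` gives a homomorphism `ρ : Lbs(X) → Lbs(X')` (`exists_retraction`). It
exists and preserves parity because `g` is homogeneous. It fixes `Lbs(X')`, kills `S`, and is the
identity modulo `Id(R)`, so `ρ` and the inclusion induce inverse isomorphisms of the two presented
superalgebras.

For the Gröbner–Shirshov property, inclusion compositions never occur: reducedness passes to `R'`
and already forbids them. A left multiplication composition `(μ f)` over `X'` is trivial over `R`,
and `ρ` transports the expression to `X'` (`trivialModDeg_map`). Terms built on `S` vanish. A term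
`[t a₁ ⋯ aₘ]_L` becomes a combination of terms `[t b₁ ⋯ bₗ]_L` of no larger degree, because `ρ` does
not raise degrees of letters and the Leibniz identity rewrites right multiplication by a word as
right multiplications by rearrangements of its letters (`mul_nf_mem_span`). -/

theorem nf_mem_induction {p : Submodule k (Lbs k par)} (h1 : ∀ a, Lbs.of k par a ∈ p)
    (h2 : ∀ w a, Lbs.nf k par w ∈ p → Lbs.nf k par w * Lbs.of k par a ∈ p) (x : Lbs k par) :
    x ∈ p := by
  have h : Submodule.span k (Set.range (Lbs.nf k par)) ≤ p := by
    rw [Submodule.span_le]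
    rintro _ ⟨w, rfl⟩
    induction w using word_snoc_induction with
    | h1 a => exact h1 a
    | h2 w a ih => rw [nf_snoc]; exact h2 w a ih
  exact h (nf_span k par Submodule.mem_top)

/-- Turns conditions on supports into membership in a span, a form to which linear maps can be
applied. -/
theorem mem_span_nf_iff {f : Lbs k par} {T : Set (FreeSemigroup X)} :
    f ∈ Submodule.span k (Lbs.nf k par '' T) ↔ ∀ w ∈ supp f, w ∈ T := by
  have : Lbs.nf k par = ⇑(Lbs.nfBasis k par) := funext fun w => (Lbs.nfBasis_apply k par w).symm
  rw [this, Module.Basis.mem_span_image]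
  rfl

theorem ofTerm_mem_grade (μ : FreeMagma X) :
    Lbs.ofTerm k par μ ∈ Lbs.grade k par (termParity par μ) :=
  ⟨_, Submodule.subset_span ⟨μ, rfl, rfl⟩, rfl⟩

theorem grade_eq_span (i : ZMod 2) : Lbs.grade k par i =
    Submodule.span k {p | ∃ μ, termParity par μ = i ∧ p = Lbs.ofTerm k par μ} := by
  rw [Lbs.grade, Submodule.map_span]
  congr 1
  ext p
  constructor
  · rintro ⟨_, ⟨μ, h, rfl⟩, rfl⟩
    exact ⟨μ, h, rfl⟩
  · rintro ⟨μ, h, rfl⟩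
    exact ⟨_, ⟨μ, h, rfl⟩, rfl⟩

theorem mem_grade_of_supp {f : Lbs k par} {i : ZMod 2} (h : ∀ w ∈ supp f, wordParity par w = i) :
    f ∈ Lbs.grade k par i := by
  have hf : f ∈ Submodule.span k (Lbs.nf k par '' {w | wordParity par w = i}) :=
    mem_span_nf_iff.2 h
  refine Submodule.span_le.2 ?_ hf
  rintro _ ⟨w, rfl, rfl⟩
  exact ofTerm_mem_grade _

theorem mul_mem_grade {i j : ZMod 2} {x y : Lbs k par} (hx : x ∈ Lbs.grade k par i)
    (hy : y ∈ Lbs.grade k par j) : x * y ∈ Lbs.grade k par (i + j) := by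
  rw [grade_eq_span] at hx hy
  induction hx using Submodule.span_induction with
  | zero => rw [zero_mul]; exact zero_mem _
  | add a b _ _ h1 h2 => rw [add_mul]; exact add_mem h1 h2
  | smul r a _ h => rw [smul_mul_assoc]; exact Submodule.smul_mem _ _ h
  | mem x hx =>
    obtain ⟨μ, rfl, rfl⟩ := hx
    induction hy using Submodule.span_induction with
    | zero => rw [mul_zero]; exact zero_mem _
    | add a b _ _ h1 h2 => rw [mul_add]; exact add_mem h1 h2
    | smul r a _ h => rw [mul_smul_comm]; exact Submodule.smul_mem _ _ h
    | mem y hy =>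
      obtain ⟨ν, rfl, rfl⟩ := hy
      rw [← ofTerm_mul]
      exact ofTerm_mem_grade (μ * ν)

/-- The defining relation is trilinear. Its sign depends only on the parities of the two right
factors, so `x` need not be homogeneous. -/
theorem leibniz_of_grade {i j : ZMod 2} (x : Lbs k par) {y z : Lbs k par}
    (hy : y ∈ Lbs.grade k par i) (hz : z ∈ Lbs.grade k par j) :
    x * (y * z) = x * y * z - superSign k i j • (x * z * y) := by
  rw [grade_eq_span] at hy hz
  induction hy using Submodule.span_induction with
  | zero => simp
  | add a b _ _ h1 h2 => simp only [add_mul, mul_add, h1, h2, smul_add]; abel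
  | smul r a _ h =>
    simp only [smul_mul_assoc, mul_smul_comm, h, smul_sub, smul_comm r]
  | mem y hy =>
    obtain ⟨ν, rfl, rfl⟩ := hy
    induction hz using Submodule.span_induction with
    | zero => simp
    | add a b _ _ h1 h2 => simp only [add_mul, mul_add, h1, h2, smul_add]; abel
    | smul r a _ h =>
      simp only [smul_mul_assoc, mul_smul_comm, h, smul_sub, smul_comm r]
    | mem z hz =>
      obtain ⟨τ, rfl, rfl⟩ := hz
      have hx : x ∈ Submodule.span k (Set.range (Lbs.nf k par)) := nf_span k par Submodule.mem_top
      induction hx using Submodule.span_induction with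
      | zero => simp
      | add a b _ _ h1 h2 => simp only [add_mul, h1, h2, smul_add]; abel
      | smul r a _ h => simp only [smul_mul_assoc, h, smul_sub, smul_comm r]
      | mem x hx =>
        obtain ⟨w, rfl⟩ := hx
        exact ofTerm_leibniz k par _ _ _

end Free

/-! ### Substitution homomorphisms -/

section Lift

variable {k : Type v} [Field k] {X Y : Type u} {par : X → ZMod 2} {par' : Y → ZMod 2}
  (φ : X → Lbs k par')

/-- The extension of a map of letters to the free non-associative algebra. -/
def Lbs.preLift : FreeNonUnitalNonAssocAlgebra k X →ₙₐ[k] Lbs k par' :=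
  FreeNonUnitalNonAssocAlgebra.lift k φ

variable {φ}

theorem preLift_of (x : X) : Lbs.preLift φ (monom k (.of x)) = φ x :=
  FreeNonUnitalNonAssocAlgebra.lift_of_apply k _ x

theorem preLift_mem_grade (hφ : ∀ x, φ x ∈ Lbs.grade k par' (par x)) (μ : FreeMagma X) :
    Lbs.preLift φ (monom k μ) ∈ Lbs.grade k par' (termParity par μ) := by
  induction μ with
  | ih1 x => rw [preLift_of]; exact hφ x
  | ih2 μ ν h1 h2 => rw [monom_mul, map_mul]; exact mul_mem_grade h1 h2

/-- Since `φ` preserves parity, a term and its image have the same parity, so each defining relation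
becomes an instance of `leibniz_of_grade` with the same sign. -/
theorem idealSpan_le_ker_preLift (hφ : ∀ x, φ x ∈ Lbs.grade k par' (par x)) :
    idealSpan k (leibnizRel k par) ≤
    LinearMap.ker (Lbs.preLift φ : FreeNonUnitalNonAssocAlgebra k X →ₗ[k] Lbs k par') := by
  refine idealSpan_le k ?_ ?_
  · intro x y hy
    have hy' : Lbs.preLift φ y = 0 := hy
    constructor
    · change Lbs.preLift φ (x * y) = 0
      rw [map_mul, hy', mul_zero]
    · change Lbs.preLift φ (y * x) = 0
      rw [map_mul, hy', zero_mul]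
  · rintro _ ⟨μ, ν, τ, rfl⟩
    change Lbs.preLift φ _ = 0
    rw [map_add, map_sub, map_smul]
    simp only [monom_mul, map_mul,
      leibniz_of_grade _ (preLift_mem_grade hφ ν) (preLift_mem_grade hφ τ)]
    abel

/-- The universal property of the free Leibniz superalgebra, for maps of letters into a free
Leibniz superalgebra that preserve parity. -/
def Lbs.lift (hφ : ∀ x, φ x ∈ Lbs.grade k par' (par x)) : Lbs k par →ₙₐ[k] Lbs k par' where
  toFun := (idealSpan k (leibnizRel k par)).liftQ
    (Lbs.preLift φ : FreeNonUnitalNonAssocAlgebra k X →ₗ[k] Lbs k par')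
    (idealSpan_le_ker_preLift hφ)
  map_smul' r x := map_smul _ r x
  map_zero' := map_zero _
  map_add' x y := map_add _ x y
  map_mul' x y := by
    obtain ⟨x, rfl⟩ := QuotAlg.mk_surjective k x
    obtain ⟨y, rfl⟩ := QuotAlg.mk_surjective k y
    exact map_mul (Lbs.preLift φ) x y

theorem Lbs.lift_of (hφ : ∀ x, φ x ∈ Lbs.grade k par' (par x)) (x : X) :
    Lbs.lift hφ (Lbs.of k par x) = φ x :=
  preLift_of x

theorem Lbs.lift_mem_grade (hφ : ∀ x, φ x ∈ Lbs.grade k par' (par x)) {i : ZMod 2} {x : Lbs k par}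
    (hx : x ∈ Lbs.grade k par i) : Lbs.lift hφ x ∈ Lbs.grade k par' i := by
  rw [grade_eq_span] at hx
  induction hx using Submodule.span_induction with
  | zero => rw [map_zero]; exact zero_mem _
  | add a b _ _ h1 h2 => rw [map_add]; exact add_mem h1 h2
  | smul r a _ h => rw [map_smul]; exact Submodule.smul_mem _ _ h
  | mem x hx =>
    obtain ⟨μ, rfl, rfl⟩ := hx
    exact preLift_mem_grade hφ μ

end Lift

/-! ### Right multiplication by words as right multiplications by letters -/

section MulLetters

variable {k : Type v} [Field k] {X : Type u} {par : X → ZMod 2}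

theorem mulLetters_concat (f : Lbs k par) (as : List X) (a : X) :
    mulLetters f (as ++ [a]) = mulLetters f as * Lbs.of k par a := by
  simp [mulLetters]

theorem mulLetters_append (f : Lbs k par) (as bs : List X) :
    mulLetters f (as ++ bs) = mulLetters (mulLetters f as) bs := by
  simp [mulLetters]

theorem mulLetters_nf (w : FreeSemigroup X) (as : List X) :
    mulLetters (Lbs.nf k par w) as = Lbs.nf k par ⟨w.head, w.tail ++ as⟩ := by
  induction as using List.reverseRecOn with
  | nil => simp [mulLetters]
  | append_singleton as a ih =>
    rw [mulLetters_concat, ih, ← nf_snoc]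
    congr 1
    ext <;> simp

/-- Induction on the word through `f(wa) = (fw)a ∓ (fa)w`: in the first summand `a` ends up last, in
the second first, and the letters of `w` are only permuted. -/
theorem mul_nf_mem_span (f : Lbs k par) (w : FreeSemigroup X) :
    f * Lbs.nf k par w ∈
      Submodule.span k {p | ∃ as : List X, as.Perm (w.head :: w.tail) ∧ p = mulLetters f as} := by
  induction w using word_snoc_induction generalizing f with
  | h1 a => exact Submodule.subset_span ⟨[a], List.Perm.refl _, rfl⟩
  | h2 w a ih =>
    have h := leibniz_of_grade f (ofTerm_mem_grade (par := par) (k := k) (leftTerm w))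
      (ofTerm_mem_grade (.of a))
    change f * (Lbs.nf k par w * Lbs.of k par a) = _ at h
    rw [nf_snoc, h]
    refine sub_mem ?_ (Submodule.smul_mem _ _ ?_)
    · refine Submodule.span_induction (p := fun g _ => g * Lbs.of k par a ∈ _) ?_
        (by rw [zero_mul]; exact zero_mem _) (fun x y _ _ h1 h2 => by
          rw [add_mul]; exact add_mem h1 h2) (fun r x _ h => by
          rw [smul_mul_assoc]; exact Submodule.smul_mem _ _ h) (ih f)
      rintro _ ⟨as, h, rfl⟩
      exact Submodule.subset_span ⟨as ++ [a], h.append_right [a], (mulLetters_concat f as a).symm⟩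
    · refine Submodule.span_mono ?_ (ih (f * Lbs.of k par a))
      rintro _ ⟨as, h, rfl⟩
      exact ⟨a :: as, (h.cons a).trans (List.perm_append_singleton a _).symm, rfl⟩

theorem mul_mem_span_mulLetters {deg : X → ℕ} {n : ℕ} (f : Lbs k par) {g : Lbs k par}
    (hg : g ∈ Submodule.span k (Lbs.nf k par '' {w | wordDeg deg w ≤ n})) :
    f * g ∈ Submodule.span k {p | ∃ as : List X, (as.map deg).sum ≤ n ∧ p = mulLetters f as} := by
  induction hg using Submodule.span_induction with
  | zero => rw [mul_zero]; exact zero_mem _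
  | add a b _ _ h1 h2 => rw [mul_add]; exact add_mem h1 h2
  | smul r a _ h => rw [mul_smul_comm]; exact Submodule.smul_mem _ _ h
  | mem g hg =>
    obtain ⟨w, hw, rfl⟩ := hg
    refine Submodule.span_mono ?_ (mul_nf_mem_span f w)
    rintro _ ⟨as, h, rfl⟩
    refine ⟨as, le_of_eq_of_le ?_ hw, rfl⟩
    rw [(h.map deg).sum_eq]
    simp [wordDeg]

end MulLetters

/-! ### Isomorphisms of quotients -/

section Quotient

variable {k : Type v} [Field k] {A B : Type*} [NonUnitalNonAssocRing A] [Module k A]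
  [NonUnitalNonAssocRing B] [Module k B]

theorem map_mem_idealSpan {S : Set A} {T : Set B} (F : A →ₙₐ[k] B)
    (hF : ∀ s ∈ S, F s ∈ idealSpan k T) {x : A} (hx : x ∈ idealSpan k S) :
    F x ∈ idealSpan k T := by
  have h : idealSpan k S ≤ (idealSpan k T).comap (F : A →ₗ[k] B) := by
    refine idealSpan_le k (fun x y hy => ?_) hF
    have hy' : F y ∈ idealSpan k T := hy
    change F (x * y) ∈ idealSpan k T ∧ F (y * x) ∈ idealSpan k T
    rw [map_mul, map_mul]
    exact isIdeal_idealSpan k T _ _ hy'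
  exact h hx

/-- Only inverse modulo the ideals is required, which is what a retraction and the inclusion
satisfy. -/
theorem superIso_of_inverse {S : Set A} {T : Set B} (F : A →ₙₐ[k] B) (G : B →ₙₐ[k] A)
    (hF : ∀ s ∈ S, F s ∈ idealSpan k T) (hG : ∀ t ∈ T, G t ∈ idealSpan k S)
    (hGF : ∀ a, G (F a) - a ∈ idealSpan k S) (hFG : ∀ b, F (G b) - b ∈ idealSpan k T)
    (𝒜 : ZMod 2 → Submodule k A) (ℬ : ZMod 2 → Submodule k B)
    (hF' : ∀ i, ∀ a ∈ 𝒜 i, F a ∈ ℬ i) (hG' : ∀ i, ∀ b ∈ ℬ i, G b ∈ 𝒜 i) :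
    SuperIso k (fun i => (𝒜 i).map (QuotAlg.mk k S)) (fun i => (ℬ i).map (QuotAlg.mk k T)) := by
  let F₁ : QuotAlg k S →ₗ[k] QuotAlg k T :=
    Submodule.mapQ _ _ (F : A →ₗ[k] B) fun _ hx => map_mem_idealSpan F hF hx
  let G₁ : QuotAlg k T →ₗ[k] QuotAlg k S :=
    Submodule.mapQ _ _ (G : B →ₗ[k] A) fun _ hx => map_mem_idealSpan G hG hx
  have hF₁ (a : A) : F₁ (QuotAlg.mk k S a) = QuotAlg.mk k T (F a) := rfl
  have hG₁ (b : B) : G₁ (QuotAlg.mk k T b) = QuotAlg.mk k S (G b) := rfl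
  have h1 (x) : G₁ (F₁ x) = x := by
    obtain ⟨a, rfl⟩ := QuotAlg.mk_surjective k x
    rw [hF₁, hG₁, QuotAlg.mk_eq_mk]
    exact hGF a
  have h2 (y) : F₁ (G₁ y) = y := by
    obtain ⟨b, rfl⟩ := QuotAlg.mk_surjective k y
    rw [hG₁, hF₁, QuotAlg.mk_eq_mk]
    exact hFG b
  have h3 (i x) (hx : x ∈ (𝒜 i).map (QuotAlg.mk k S)) : F₁ x ∈ (ℬ i).map (QuotAlg.mk k T) := by
    obtain ⟨a, ha, rfl⟩ := hx
    exact ⟨F a, hF' i a ha, rfl⟩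
  have h4 (i y) (hy : y ∈ (ℬ i).map (QuotAlg.mk k T)) : G₁ y ∈ (𝒜 i).map (QuotAlg.mk k S) := by
    obtain ⟨b, hb, rfl⟩ := hy
    exact ⟨G b, hG' i b hb, rfl⟩
  refine ⟨LinearEquiv.ofLinearMap F₁ G₁ (LinearMap.ext h2) (LinearMap.ext h1), fun x y => ?_,
    fun i x => ⟨fun h => ?_, h3 i x⟩⟩
  · obtain ⟨a, rfl⟩ := QuotAlg.mk_surjective k x
    obtain ⟨b, rfl⟩ := QuotAlg.mk_surjective k y
    change QuotAlg.mk k T (F (a * b)) = QuotAlg.mk k T (F a * F b)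
    rw [map_mul]
  · rw [← h1 x]
    exact h4 i _ h

end Quotient

/-! ### The deg-length-lex order -/

section WordOrder

variable {X : Type u} {deg : X → ℕ}

/-- Appending a list of letters to a word. -/
def appendList (w : FreeSemigroup X) (as : List X) : FreeSemigroup X := ⟨w.head, w.tail ++ as⟩

/-- The word obtained by applying a map to each letter. -/
def mapWord {Y : Type u} (f : Y → X) (w : FreeSemigroup Y) : FreeSemigroup X :=
  ⟨f w.head, w.tail.map f⟩

theorem mapWord_injective {Y : Type u} {f : Y → X} (hf : Function.Injective f) :
    Function.Injective (mapWord f) := by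
  rintro ⟨a, l⟩ ⟨b, m⟩ h
  simp only [mapWord, FreeSemigroup.mk.injEq] at h
  rw [hf h.1, List.map_injective_iff.2 hf h.2]

theorem wordDeg_mapWord {Y : Type u} (f : Y → X) (w : FreeSemigroup Y) :
    wordDeg deg (mapWord f w) = wordDeg (deg ∘ f) w := by
  simp [wordDeg, mapWord]

theorem length_mapWord {Y : Type u} (f : Y → X) (w : FreeSemigroup Y) :
    (mapWord f w).length = w.length := by
  simp [FreeSemigroup.length, mapWord]

theorem wordParity_mapWord {Y : Type u} (par : X → ZMod 2) (f : Y → X) (w : FreeSemigroup Y) :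
    wordParity par (mapWord f w) = wordParity (par ∘ f) w := by
  induction w using word_snoc_induction with
  | h1 a => rfl
  | h2 w a ih =>
    have : mapWord f (w * .of a) = mapWord f w * .of (f a) := by ext <;> simp [mapWord]
    rw [this, wordParity_snoc, wordParity_snoc, ih]
    rfl

theorem wordDeg_appendList (w : FreeSemigroup X) (as : List X) :
    wordDeg deg (appendList w as) = wordDeg deg w + (as.map deg).sum := by
  simp [wordDeg, appendList, add_assoc]

theorem length_appendList (w : FreeSemigroup X) (as : List X) :
    (appendList w as).length = w.length + as.length := by
  simp [FreeSemigroup.length, appendList, add_right_comm]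

theorem eq_of_of_length_eq_one {w : FreeSemigroup X} (h : w.length = 1) : ∃ x, w = .of x := by
  obtain ⟨x, l⟩ := w
  simp only [FreeSemigroup.length, add_eq_right, List.length_eq_zero_iff] at h
  exact ⟨x, by rw [h]; rfl⟩

theorem deg_le_wordDeg {w : FreeSemigroup X} {y : X} (hy : y ∈ w.head :: w.tail) :
    deg y ≤ wordDeg deg w := by
  have := List.le_sum_of_mem (List.mem_map_of_mem (f := deg) hy)
  simpa [wordDeg] using this

variable [LinearOrder X]

theorem lex_append {l m : List X} (h : List.Lex (· < ·) l m) (hl : l.length = m.length)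
    (as bs : List X) : List.Lex (· < ·) (l ++ as) (m ++ bs) := by
  induction h with
  | nil => simp at hl
  | cons _ ih => exact .cons (ih (by simpa using hl))
  | rel h => exact .rel h

theorem lex_append_left {l m : List X} (h : List.Lex (· < ·) l m) (as : List X) :
    List.Lex (· < ·) (as ++ l) (as ++ m) := by
  induction as with
  | nil => exact h
  | cons a as ih => exact .cons ih

theorem lex_map_iff {Y : Type u} [LinearOrder Y] {f : Y → X} (hf : StrictMono f) {l m : List Y} :
    List.Lex (· < ·) (l.map f) (m.map f) ↔ List.Lex (· < ·) l m := by
  induction l generalizing m with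
  | nil => cases m <;> simp
  | cons a l ih =>
    cases m with
    | nil => simp
    | cons b m => simp [List.cons_lex_cons_iff, ih, hf.lt_iff_lt, hf.injective.eq_iff]

theorem WordLT.asymm {μ ν : FreeSemigroup X} (h : WordLT deg μ ν) : ¬ WordLT deg ν μ := by
  have hl : List.Lex (· < ·) (μ.head :: μ.tail) (ν.head :: ν.tail) →
      ¬ List.Lex (· < ·) (ν.head :: ν.tail) (μ.head :: μ.tail) :=
    fun h h' => lt_asymm (α := List X) h h'
  unfold WordLT at *
  rcases h with h | ⟨h, h' | ⟨h', h''⟩⟩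
  · omega
  · omega
  · rintro (h₁ | ⟨_, h₁ | ⟨_, h₁⟩⟩)
    · omega
    · omega
    · exact hl h'' h₁

theorem WordLT.irrefl (μ : FreeSemigroup X) : ¬ WordLT deg μ μ := fun h => h.asymm h

theorem wordLT_mapWord_iff {Y : Type u} [LinearOrder Y] {f : Y → X} (hf : StrictMono f)
    {μ ν : FreeSemigroup Y} :
    WordLT deg (mapWord f μ) (mapWord f ν) ↔ WordLT (deg ∘ f) μ ν := by
  unfold WordLT
  rw [wordDeg_mapWord, wordDeg_mapWord, length_mapWord, length_mapWord,
    ← lex_map_iff hf]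
  rfl

/-- Lexicographic comparison survives appending because it is consulted only for words of equal
length. -/
theorem WordLT.appendList {μ ν : FreeSemigroup X} (h : WordLT deg μ ν) (as : List X) :
    WordLT deg (appendList μ as) (appendList ν as) := by
  unfold WordLT
  rw [wordDeg_appendList, wordDeg_appendList, length_appendList, length_appendList]
  rcases h with h | ⟨h, h' | ⟨h', h''⟩⟩
  · omega
  · omega
  · exact Or.inr ⟨by omega, Or.inr ⟨by omega, lex_append h'' h' as as⟩⟩

theorem wordDeg_le_of_wordLT {μ ν : FreeSemigroup X} (h : WordLT deg μ ν) :
    wordDeg deg μ ≤ wordDeg deg ν := by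
  rcases h with h | h <;> omega

/-- A word smaller than a letter is of smaller degree or a smaller letter. -/
theorem wordLT_of_iff {w : FreeSemigroup X} {y : X} : WordLT deg w (.of y) ↔
    wordDeg deg w < deg y ∨ wordDeg deg w = deg y ∧ ∃ z < y, w = .of z := by
  have h1 : wordDeg deg (.of y) = deg y := by simp [wordDeg]
  unfold WordLT
  rw [h1]
  refine or_congr_right (and_congr_right fun _ => ?_)
  obtain ⟨a, l⟩ := w
  constructor
  · rintro (h | ⟨h, h'⟩)
    · simp [FreeSemigroup.length] at h
    · obtain ⟨z, hz⟩ := eq_of_of_length_eq_one h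
      refine ⟨z, ?_, hz⟩
      rw [hz] at h'
      simpa [List.lex_cons_iff, List.cons_lex_cons_iff] using h'
  · rintro ⟨z, hz, h⟩
    rw [h]
    exact Or.inr ⟨rfl, .rel hz⟩

/-- A word containing `y` has degree at least `deg y`; in case of equality a smaller word must be a
single smaller letter. -/
theorem not_mem_of_wordLT_of {w : FreeSemigroup X} {y : X} (h : WordLT deg w (.of y)) :
    y ∉ w.head :: w.tail := by
  intro hy
  have := deg_le_wordDeg (deg := deg) hy
  rcases wordLT_of_iff.1 h with h | ⟨_, z, hz, rfl⟩
  · omega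
  · rw [show (FreeSemigroup.of z).head :: (FreeSemigroup.of z).tail = [z] from rfl,
      List.mem_singleton] at hy
    exact hz.ne' hy

/-- Permuting the letters of `w` is harmless here: either the degree drops strictly, or `w` is a
single letter and there is nothing to permute. -/
theorem wordLT_appendList_perm {u w : FreeSemigroup X} {y : X} (h : WordLT deg w (.of y))
    {as : List X} (has : as.Perm (w.head :: w.tail)) :
    WordLT deg (appendList u as) (appendList u [y]) := by
  have hs : (as.map deg).sum = wordDeg deg w := by
    rw [(has.map deg).sum_eq]; simp [wordDeg]
  unfold WordLT
  rw [wordDeg_appendList, wordDeg_appendList, length_appendList, length_appendList, hs]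
  rcases wordLT_of_iff.1 h with h | ⟨h, z, hz, rfl⟩
  · left; simpa using h
  · obtain rfl : as = [z] := List.perm_singleton.1 has
    refine Or.inr ⟨by simp [h], Or.inr ⟨rfl, ?_⟩⟩
    exact lex_append_left (as := u.head :: u.tail) (.rel hz)

end WordOrder

/-! ### Leading monomials of normal polynomials -/

section Leading

variable {k : Type v} [Field k] {X : Type u} {par : X → ZMod 2}

theorem mem_supp {f : Lbs k par} {w : FreeSemigroup X} :
    w ∈ supp f ↔ (Lbs.nfBasis k par).repr f w ≠ 0 := Finsupp.mem_support_iff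

theorem repr_nf [DecidableEq (FreeSemigroup X)] (w v : FreeSemigroup X) :
    (Lbs.nfBasis k par).repr (Lbs.nf k par w) v = if w = v then 1 else 0 := by
  rw [← Lbs.nfBasis_apply, Module.Basis.repr_self, Finsupp.single_apply]

theorem mem_supp_sub_nf {f : Lbs k par} {μ w : FreeSemigroup X}
    (h : (Lbs.nfBasis k par).repr f μ = 1) :
    w ∈ supp (f - Lbs.nf k par μ) ↔ w ∈ supp f ∧ w ≠ μ := by
  classical
  rw [mem_supp, mem_supp, map_sub, Finsupp.sub_apply, repr_nf]
  by_cases hw : μ = w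
  · subst hw; simp [h]
  · simp [hw, Ne.symm hw]

/-- Right multiplication by a list of letters. -/
def mulLettersHom (as : List X) : Lbs k par →ₗ[k] Lbs k par where
  toFun f := mulLetters f as
  map_add' f g := by
    induction as using List.reverseRecOn with
    | nil => rfl
    | append_singleton as a ih => simp only [mulLetters_concat, ih, add_mul]
  map_smul' r f := by
    induction as using List.reverseRecOn with
    | nil => rfl
    | append_singleton as a ih =>
      simp only [mulLetters_concat, ih, smul_mul_assoc, RingHom.id_apply]

theorem mulLettersHom_apply (as : List X) (f : Lbs k par) :
    mulLettersHom as f = mulLetters f as := rfl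

variable [LinearOrder X] {deg : X → ℕ}

theorem IsLeading.unique {f : Lbs k par} {μ ν : FreeSemigroup X} (h : IsLeading deg f μ)
    (h' : IsLeading deg f ν) : μ = ν := by
  by_contra hne
  exact (h.2 ν h'.1 (Ne.symm hne)).asymm (h'.2 μ h.1 hne)

theorem IsMonic.sub_nf_mem {f : Lbs k par} {μ : FreeSemigroup X} (hf : IsMonic deg f)
    (h : IsLeading deg f μ) :
    f - Lbs.nf k par μ ∈ Submodule.span k (Lbs.nf k par '' {w | w ∈ supp f ∧ w ≠ μ}) := by
  obtain ⟨μ', h', h1⟩ := hf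
  obtain rfl := h.unique h'
  rw [mem_span_nf_iff]
  exact fun w hw => (mem_supp_sub_nf h1).1 hw

theorem IsMonic.sub_nf_mem_lt {f : Lbs k par} {μ : FreeSemigroup X} (hf : IsMonic deg f)
    (h : IsLeading deg f μ) :
    f - Lbs.nf k par μ ∈ Submodule.span k (Lbs.nf k par '' {w | WordLT deg w μ}) :=
  Submodule.span_mono (Set.image_mono fun w hw => h.2 w hw.1 hw.2) (hf.sub_nf_mem h)

/-- "Monic with leading monomial `μ`" is recorded as "`f - μ` is a combination of words below `μ`",
a statement that passes through multiplication termwise. -/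
theorem isLeading_of_sub_nf_mem {f : Lbs k par} {μ : FreeSemigroup X}
    (h : f - Lbs.nf k par μ ∈ Submodule.span k (Lbs.nf k par '' {w | WordLT deg w μ})) :
    IsLeading deg f μ := by
  classical
  rw [mem_span_nf_iff] at h
  -- Any other coefficient would leave `μ` in the support of `f - μ`, giving `μ < μ`.
  have h0 : (Lbs.nfBasis k par).repr f μ = 1 := by
    by_contra hne
    refine WordLT.irrefl μ (h μ ?_)
    rw [mem_supp, map_sub, Finsupp.sub_apply, repr_nf, if_pos rfl]
    exact sub_ne_zero.2 hne
  refine ⟨by rw [mem_supp, h0]; exact one_ne_zero, fun w hw hne => h w ?_⟩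
  exact (mem_supp_sub_nf h0).2 ⟨hw, hne⟩

theorem sub_nf_mem_mulLetters {f : Lbs k par} {μ : FreeSemigroup X}
    (h : f - Lbs.nf k par μ ∈ Submodule.span k (Lbs.nf k par '' {w | WordLT deg w μ}))
    (as : List X) : mulLetters f as - Lbs.nf k par (appendList μ as) ∈
      Submodule.span k (Lbs.nf k par '' {w | WordLT deg w (appendList μ as)}) := by
  have h' := Submodule.mem_map_of_mem (f := mulLettersHom as) h
  rw [Submodule.map_span, map_sub, mulLettersHom_apply, mulLettersHom_apply, mulLetters_nf] at h'
  refine Submodule.span_mono ?_ h'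
  rintro _ ⟨_, ⟨w, hw, rfl⟩, rfl⟩
  exact ⟨_, hw.appendList as, (mulLetters_nf w as).symm⟩

theorem isLeading_mulLetters {f : Lbs k par} {μ : FreeSemigroup X} (hf : IsMonic deg f)
    (h : IsLeading deg f μ) (as : List X) :
    IsLeading deg (mulLetters f as) (appendList μ as) :=
  isLeading_of_sub_nf_mem (sub_nf_mem_mulLetters (hf.sub_nf_mem_lt h) as)

/-- The leading monomial must be a letter: `u w` expands into `u` followed by rearrangements of `w`,
and for `w < y` all of these lie below `u y`. With a longer leading word, left multiplication can
even give zero, as in `u(aa) = 0` for an even letter `a`. -/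
theorem sub_nf_mem_nf_mul {g : Lbs k par} {y : X} (hg : IsMonic deg g)
    (h : IsLeading deg g (.of y)) (u : FreeSemigroup X) :
    Lbs.nf k par u * g - Lbs.nf k par (appendList u [y]) ∈
      Submodule.span k (Lbs.nf k par '' {w | WordLT deg w (appendList u [y])}) := by
  have h1 : Lbs.nf k par (appendList u [y]) = Lbs.nf k par u * Lbs.nf k par (.of y) :=
    nf_snoc k par u y
  rw [h1, ← mul_sub]
  refine Submodule.span_induction (p := fun z _ => Lbs.nf k par u * z ∈ _) ?_
    (by rw [mul_zero]; exact zero_mem _) (fun a b _ _ h1 h2 => by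
      rw [mul_add]; exact add_mem h1 h2) (fun r a _ h => by
      rw [mul_smul_comm]; exact Submodule.smul_mem _ _ h) (hg.sub_nf_mem_lt h)
  rintro _ ⟨w, hw, rfl⟩
  refine Submodule.span_mono ?_ (mul_nf_mem_span (Lbs.nf k par u) w)
  rintro _ ⟨as, has, rfl⟩
  exact ⟨_, wordLT_appendList_perm hw has, (mulLetters_nf u as).symm⟩

/-- Each word containing the letter `y` is the leading monomial of a normal polynomial `h_g`, if
`y` is the leading monomial of `g`. -/
theorem exists_isNormalPoly_of_mem {g : Lbs k par} {y : X} (hg : IsMonic deg g)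
    (h : IsLeading deg g (.of y)) {w : FreeSemigroup X} (hy : y ∈ w.head :: w.tail) :
    ∃ p, IsNormalPoly deg g p ∧ IsLeading deg p w := by
  obtain ⟨a, l⟩ := w
  obtain ⟨s, t, hst⟩ := List.append_of_mem hy
  cases s with
  | nil =>
    simp only [List.nil_append, List.cons.injEq] at hst
    obtain ⟨rfl, rfl⟩ := hst
    exact ⟨_, .right l, isLeading_mulLetters hg h l⟩
  | cons b s =>
    simp only [List.cons_append, List.cons.injEq] at hst
    obtain ⟨rfl, rfl⟩ := hst
    -- The letters before `y` form the nonempty left factor, those after it are multiplied on the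
    -- right.
    refine ⟨_, .mid ⟨a, s⟩ t ⟨y, h⟩, ?_⟩
    have := isLeading_of_sub_nf_mem (sub_nf_mem_mulLetters (sub_nf_mem_nf_mul hg h ⟨a, s⟩) t)
    simpa [appendList] using this

end Leading

/-! ### Transfer along the inclusion of letters -/

section Incl

variable {k : Type v} [Field k] {X : Type u} {par : X → ZMod 2} {Y : Set X}

theorem incl_of (y : Y) : Lbs.incl k par Y (Lbs.of k _ y) = Lbs.of k par y :=
  Lbs.map_of k par _ y

theorem incl_mulLetters (f : Lbs k (par ∘ ((↑) : Y → X))) (as : List Y) :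
    Lbs.incl k par Y (mulLetters f as) = mulLetters (Lbs.incl k par Y f) (as.map (↑)) := by
  induction as using List.reverseRecOn with
  | nil => rfl
  | append_singleton as a ih =>
    rw [mulLetters_concat, map_mul, ih, incl_of, List.map_append, List.map_singleton,
      mulLetters_concat]

theorem incl_nf (w : FreeSemigroup Y) :
    Lbs.incl k par Y (Lbs.nf k _ w) = Lbs.nf k par (mapWord (↑) w) := by
  have h (Z : Type u) (q : Z → ZMod 2) (w : FreeSemigroup Z) :
      Lbs.nf k q w = mulLetters (Lbs.of k q w.head) w.tail := (mulLetters_nf (.of w.head) w.tail).symm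
  rw [h, h, incl_mulLetters, incl_of]
  rfl

/-- On coordinates the inclusion merely relabels words, injectively; injectivity and the comparison
of supports and leading monomials rest on this. -/
theorem repr_incl (f : Lbs k (par ∘ ((↑) : Y → X))) :
    (Lbs.nfBasis k par).repr (Lbs.incl k par Y f) =
      ((Lbs.nfBasis k (par ∘ ((↑) : Y → X))).repr f).mapDomain (mapWord (↑)) := by
  have h : (Lbs.nfBasis k par).repr.toLinearMap ∘ₗ
      (Lbs.incl k par Y : Lbs k (par ∘ ((↑) : Y → X)) →ₗ[k] Lbs k par) =
      Finsupp.lmapDomain k k (mapWord ((↑) : Y → X)) ∘ₗ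
        (Lbs.nfBasis k (par ∘ ((↑) : Y → X))).repr.toLinearMap := by
    refine (Lbs.nfBasis k (par ∘ ((↑) : Y → X))).ext fun w => ?_
    change (Lbs.nfBasis k par).repr (Lbs.incl k par Y (Lbs.nfBasis k _ w)) =
      Finsupp.mapDomain _ ((Lbs.nfBasis k (par ∘ ((↑) : Y → X))).repr (Lbs.nfBasis k _ w))
    rw [Module.Basis.repr_self, Finsupp.mapDomain_single, Lbs.nfBasis_apply, incl_nf,
      ← Lbs.nfBasis_apply, Module.Basis.repr_self]
  exact LinearMap.congr_fun h f

theorem mapWord_val_injective : Function.Injective (mapWord ((↑) : Y → X)) :=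
  mapWord_injective Subtype.val_injective

theorem repr_incl_mapWord (f : Lbs k (par ∘ ((↑) : Y → X))) (w : FreeSemigroup Y) :
    (Lbs.nfBasis k par).repr (Lbs.incl k par Y f) (mapWord (↑) w) =
      (Lbs.nfBasis k (par ∘ ((↑) : Y → X))).repr f w := by
  rw [repr_incl, Finsupp.mapDomain_apply mapWord_val_injective]

theorem mem_supp_incl {f : Lbs k (par ∘ ((↑) : Y → X))} {w : FreeSemigroup X} :
    w ∈ supp (Lbs.incl k par Y f) ↔ ∃ v ∈ supp f, mapWord (↑) v = w := by
  classical
  rw [supp, repr_incl, Finsupp.mapDomain_support_of_injective mapWord_val_injective,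
    Finset.mem_image]
  rfl

theorem mapWord_mem_supp_incl {f : Lbs k (par ∘ ((↑) : Y → X))} {v : FreeSemigroup Y} :
    mapWord (↑) v ∈ supp (Lbs.incl k par Y f) ↔ v ∈ supp f := by
  rw [mem_supp, mem_supp, repr_incl_mapWord]

theorem incl_injective : Function.Injective (Lbs.incl k par Y) := by
  intro f g h
  refine (Lbs.nfBasis k (par ∘ ((↑) : Y → X))).repr.injective (Finsupp.ext fun w => ?_)
  rw [← repr_incl_mapWord, h, repr_incl_mapWord]

theorem exists_incl_eq {f : Lbs k par}
    (hf : f ∈ Submodule.span k (Lbs.nf k par '' {w | ∀ y ∈ w.head :: w.tail, y ∈ Y})) :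
    ∃ f', Lbs.incl k par Y f' = f := by
  suffices h : Submodule.span k (Lbs.nf k par '' {w | ∀ y ∈ w.head :: w.tail, y ∈ Y}) ≤
      LinearMap.range (Lbs.incl k par Y : Lbs k (par ∘ ((↑) : Y → X)) →ₗ[k] Lbs k par) from h hf
  rw [Submodule.span_le]
  rintro _ ⟨⟨a, l⟩, hw, rfl⟩
  have ha : a ∈ Y := hw a List.mem_cons_self
  have hl : ∀ y ∈ l, y ∈ Y := fun y hy => hw y (List.mem_cons_of_mem _ hy)
  refine ⟨Lbs.nf k _ ⟨⟨a, ha⟩, l.pmap Subtype.mk hl⟩, (incl_nf _).trans ?_⟩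
  congr 1
  simp [mapWord, List.map_pmap]

theorem incl_mem_grade {i : ZMod 2} {f : Lbs k (par ∘ ((↑) : Y → X))}
    (hf : f ∈ Lbs.grade k (par ∘ ((↑) : Y → X)) i) : Lbs.incl k par Y f ∈ Lbs.grade k par i := by
  rw [grade_eq_span] at hf
  induction hf using Submodule.span_induction with
  | zero => rw [map_zero]; exact zero_mem _
  | add a b _ _ h1 h2 => rw [map_add]; exact add_mem h1 h2
  | smul r a _ h => rw [map_smul]; exact Submodule.smul_mem _ _ h
  | mem x hx =>
    obtain ⟨μ, rfl, rfl⟩ := hx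
    rw [← termParity_map]
    have := ofTerm_mem_grade (k := k) (par := par) (FreeMagma.map ((↑) : Y → X) μ)
    rwa [← preMap_monom] at this

theorem IsHomogeneous.of_incl {f : Lbs k (par ∘ ((↑) : Y → X))}
    (h : IsHomogeneous (Lbs.incl k par Y f)) : IsHomogeneous f := by
  obtain ⟨i, h⟩ := h
  refine ⟨i, fun w hw => ?_⟩
  rw [← wordParity_mapWord]
  exact h _ (mapWord_mem_supp_incl.2 hw)

variable [LinearOrder X] {deg : X → ℕ}

theorem isLeading_incl_iff {f : Lbs k (par ∘ ((↑) : Y → X))} {v : FreeSemigroup Y} :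
    IsLeading deg (Lbs.incl k par Y f) (mapWord (↑) v) ↔
      IsLeading (deg ∘ ((↑) : Y → X)) f v := by
  have hm : StrictMono ((↑) : Y → X) := Subtype.strictMono_coe _
  unfold IsLeading
  rw [mapWord_mem_supp_incl]
  refine and_congr_right fun _ => ⟨fun h w hw hne => ?_, fun h w hw hne => ?_⟩
  · rw [← wordLT_mapWord_iff hm]
    exact h _ (mapWord_mem_supp_incl.2 hw) (mapWord_val_injective.ne hne)
  · obtain ⟨w, hw', rfl⟩ := mem_supp_incl.1 hw
    rw [wordLT_mapWord_iff hm]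
    exact h w hw' fun h => hne (h ▸ rfl)

theorem IsMonic.of_incl {f : Lbs k (par ∘ ((↑) : Y → X))}
    (h : IsMonic deg (Lbs.incl k par Y f)) : IsMonic (deg ∘ ((↑) : Y → X)) f := by
  obtain ⟨ν, h1, h2⟩ := h
  obtain ⟨v, _, rfl⟩ := mem_supp_incl.1 h1.1
  exact ⟨v, isLeading_incl_iff.1 h1, by rwa [repr_incl_mapWord] at h2⟩

theorem IsNormalPoly.incl {s p : Lbs k (par ∘ ((↑) : Y → X))}
    (h : IsNormalPoly (deg ∘ ((↑) : Y → X)) s p) :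
    IsNormalPoly deg (Lbs.incl k par Y s) (Lbs.incl k par Y p) := by
  cases h with
  | right as => rw [incl_mulLetters]; exact .right _
  | mid μ as hs =>
    rw [incl_mulLetters, map_mul, incl_nf]
    obtain ⟨x, hx⟩ := hs
    exact .mid _ _ ⟨x, isLeading_incl_iff.2 hx⟩

end Incl

/-! ### Images of right multiplications under a homomorphism -/

section MapMulLetters

variable {k : Type v} [Field k] {X : Type u} {par : X → ZMod 2} {deg : X → ℕ}

/-- Each `ρ(a)` is a combination of words of degree at most `deg a`, and multiplying by such a word
on the right amounts to multiplying by its letters in various orders. -/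
theorem map_mulLetters_mem_span {Y : Type u} {par' : Y → ZMod 2} {deg' : Y → ℕ}
    (ρ : Lbs k par →ₙₐ[k] Lbs k par')
    (hρ : ∀ x, ρ (Lbs.of k par x) ∈ Submodule.span k (Lbs.nf k par' '' {w | wordDeg deg' w ≤ deg x}))
    (f : Lbs k par) (as : List X) :
    ρ (mulLetters f as) ∈ Submodule.span k
      {p | ∃ bs : List Y, (bs.map deg').sum ≤ (as.map deg).sum ∧ p = mulLetters (ρ f) bs} := by
  induction as using List.reverseRecOn with
  | nil => exact Submodule.subset_span ⟨[], by simp, rfl⟩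
  | append_singleton as a ih =>
    rw [mulLetters_concat, map_mul]
    refine Submodule.span_induction (p := fun z _ => z * ρ (Lbs.of k par a) ∈ _) ?_
      (by rw [zero_mul]; exact zero_mem _) (fun a b _ _ h1 h2 => by
        rw [add_mul]; exact add_mem h1 h2) (fun r a _ h => by
        rw [smul_mul_assoc]; exact Submodule.smul_mem _ _ h) ih
    rintro _ ⟨bs, hbs, rfl⟩
    refine Submodule.span_mono ?_ (mul_mem_span_mulLetters (mulLetters (ρ f) bs) (hρ a))
    rintro _ ⟨cs, hcs, rfl⟩
    refine ⟨bs ++ cs, ?_, (mulLetters_append _ _ _).symm⟩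
    simp only [List.map_append, List.sum_append, List.map_singleton, List.sum_singleton]
    omega

theorem map_mulLetters_eq_zero {Y : Type u} {par' : Y → ZMod 2} (ρ : Lbs k par →ₙₐ[k] Lbs k par')
    {f : Lbs k par} (hf : ρ f = 0) (as : List X) : ρ (mulLetters f as) = 0 := by
  induction as using List.reverseRecOn with
  | nil => exact hf
  | append_singleton as a ih => rw [mulLetters_concat, map_mul, ih, zero_mul]

end MapMulLetters

/-! ### Consequences of reducedness and the retraction -/

section Reduced

variable {k : Type v} [Field k] {X : Type u} [LinearOrder X] {par : X → ZMod 2} {deg : X → ℕ}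
  {R : Set (Lbs k par)}

theorem exists_isLeading_of_notMem_restLetters {y : X} (hy : y ∉ restLetters deg R) :
    ∃ g ∈ letterPart deg R, IsLeading deg g (.of y) := not_not.1 hy

theorem notMem_restLetters {g : Lbs k par} {y : X} (hg : g ∈ R) (h : IsLeading deg g (.of y)) :
    y ∉ restLetters deg R :=
  fun hy => hy ⟨g, ⟨hg, _, h, rfl⟩, h⟩

/-- A word in the support of an element of a reduced basis has no letter outside `X'`, unless it is
the leading letter of that element. -/
theorem eq_of_of_mem_supp (hR : IsReducedGSBasis deg R) {s : Lbs k par} (hs : s ∈ R)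
    {w : FreeSemigroup X} (hw : w ∈ supp s) {y : X} (hy : y ∈ w.head :: w.tail)
    (hyR : y ∉ restLetters deg R) : IsLeading deg s (.of y) ∧ w = .of y := by
  obtain ⟨g, hg, hgy⟩ := exists_isLeading_of_notMem_restLetters hyR
  -- Otherwise `w` would be the leading monomial of a normal polynomial on `g ∈ R \ {s}`.
  obtain rfl : g = s := by
    by_contra hne
    obtain ⟨p, hp, hpw⟩ := exists_isNormalPoly_of_mem (hR.monic g hg.1) hgy hy
    exact hR.reduced s hs w hw g ⟨hg.1, hne⟩ p hp hpw
  refine ⟨hgy, ?_⟩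
  by_contra hne
  exact not_mem_of_wordLT_of (hgy.2 w hw hne) hy

theorem mem_range_incl (hR : IsReducedGSBasis deg R) {s : Lbs k par}
    (hs : s ∈ R \ letterPart deg R) : ∃ s', Lbs.incl k par (restLetters deg R) s' = s := by
  refine exists_incl_eq (mem_span_nf_iff.2 fun w hw y hy => ?_)
  by_contra hyR
  exact hs.2 ⟨hs.1, _, (eq_of_of_mem_supp hR hs.1 hw hy hyR).1, rfl⟩

/-- A letter outside `X'` is congruent, modulo an element of `S`, to an element of `Lbs(X')`. -/
theorem exists_reduction (hR : IsReducedGSBasis deg R) (x : X) :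
    ∃ p : Lbs k (par ∘ ((↑) : restLetters deg R → X)),
      (∀ hx : x ∈ restLetters deg R, p = Lbs.of k _ ⟨x, hx⟩) ∧
      (∀ g ∈ R, IsLeading deg g (.of x) → Lbs.of k par x - Lbs.incl k par _ p = g) ∧
      (x ∉ restLetters deg R → ∃ g ∈ R, IsLeading deg g (.of x)) ∧
      p ∈ Lbs.grade k _ (par x) ∧
      p ∈ Submodule.span k
        (Lbs.nf k _ '' {w | wordDeg (deg ∘ ((↑) : restLetters deg R → X)) w ≤ deg x}) := by
  by_cases hx : x ∈ restLetters deg R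
  · refine ⟨Lbs.of k _ ⟨x, hx⟩, fun _ => rfl, fun g hg h => absurd hx (notMem_restLetters hg h),
      fun h => absurd hx h, ofTerm_mem_grade (FreeMagma.of (⟨x, hx⟩ : restLetters deg R)), ?_⟩
    refine Submodule.subset_span ⟨.of ⟨x, hx⟩, ?_, rfl⟩
    simp [wordDeg]
  · obtain ⟨g, hg, hgx⟩ := exists_isLeading_of_notMem_restLetters hx
    have h1 := (hR.monic g hg.1).sub_nf_mem hgx
    -- `p` is minus the tail of `g`, so that `g = x - p`; no word of the tail contains a letter
    -- outside `X'`.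
    obtain ⟨p, hp⟩ : ∃ p, Lbs.incl k par (restLetters deg R) p = -(g - Lbs.nf k par (.of x)) := by
      refine exists_incl_eq (neg_mem (Submodule.span_mono (Set.image_mono ?_) h1))
      intro w hw y hy
      by_contra hyR
      obtain ⟨h2, rfl⟩ := eq_of_of_mem_supp hR hg.1 hw.1 hy hyR
      exact hw.2 (h2.unique hgx)
    have hsupp : ∀ v ∈ supp p, mapWord (↑) v ∈ supp g ∧
        mapWord ((↑) : restLetters deg R → X) v ≠ .of x := by
      intro v hv
      refine mem_span_nf_iff.1 (hp ▸ neg_mem h1) _ (mapWord_mem_supp_incl.2 hv)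
    refine ⟨p, fun h => absurd h hx, fun g' hg' h' => ?_, fun _ => ⟨g, hg.1, hgx⟩,
      mem_grade_of_supp fun v hv => ?_, mem_span_nf_iff.2 fun v hv => ?_⟩
    -- Two elements of `R` cannot share the leading letter `x`, by reducedness.
    · obtain rfl : g' = g := by
        by_contra hne
        obtain ⟨q, hq, hqx⟩ := exists_isNormalPoly_of_mem (w := .of x) (hR.monic g' hg') h'
          (List.mem_singleton_self x)
        exact hR.reduced g hg.1 _ hgx.1 g' ⟨hg', hne⟩ q hq hqx
      rw [hp, ← nf_of]
      abel
    · obtain ⟨i, hi⟩ := hR.homogeneous g hg.1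
      rw [← wordParity_mapWord, hi _ (hsupp v hv).1, ← hi _ hgx.1, wordParity_of]
    · have h2 := hgx.2 _ (hsupp v hv).1 (hsupp v hv).2
      have h3 := wordDeg_le_of_wordLT h2
      rw [wordDeg_mapWord] at h3
      simpa [wordDeg] using h3

/-- A retraction of `Lbs(X)` onto `Lbs(X')` that kills the elements of `R` with leading monomial of
length `1`. -/
theorem exists_retraction (hR : IsReducedGSBasis deg R) :
    ∃ ρ : Lbs k par →ₙₐ[k] Lbs k (par ∘ ((↑) : restLetters deg R → X)),
      (∀ f, ρ (Lbs.incl k par _ f) = f) ∧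
      (∀ g ∈ letterPart deg R, ρ g = 0) ∧
      (∀ f, Lbs.incl k par _ (ρ f) - f ∈ idealSpan k R) ∧
      (∀ i, ∀ f ∈ Lbs.grade k par i, ρ f ∈ Lbs.grade k _ i) ∧
      ∀ x, ρ (Lbs.of k par x) ∈ Submodule.span k
        (Lbs.nf k _ '' {w | wordDeg (deg ∘ ((↑) : restLetters deg R → X)) w ≤ deg x}) := by
  choose φ h1 h2 h3 h4 h5 using exists_reduction hR
  have hρ := Lbs.lift_of h4
  have hincl (f) : Lbs.lift h4 (Lbs.incl k par _ f) = f := by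
    -- The locus where the composite agrees with the identity; it contains the letters and is stable
    -- under right multiplication by them.
    let p : Submodule k (Lbs k (par ∘ ((↑) : restLetters deg R → X))) :=
      LinearMap.eqLocus (((Lbs.lift h4).comp (Lbs.incl k par (restLetters deg R))) :
        Lbs k (par ∘ ((↑) : restLetters deg R → X)) →ₗ[k] _) LinearMap.id
    have hof (a) : Lbs.lift h4 (Lbs.incl k par _ (Lbs.of k (par ∘ ((↑) : restLetters deg R → X)) a))
        = Lbs.of k _ a := by rw [incl_of, hρ, h1 _ a.2]
    have hp (z) : z ∈ p ↔ Lbs.lift h4 (Lbs.incl k par _ z) = z := Iff.rfl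
    refine (hp f).1 (nf_mem_induction hof (fun w a hw => ?_) f)
    rw [hp] at hw ⊢
    rw [map_mul, map_mul, hw, hof]
  refine ⟨Lbs.lift h4, hincl, fun g hg => ?_, fun f => ?_, fun i f hf => Lbs.lift_mem_grade h4 hf,
    fun x => by rw [hρ]; exact h5 x⟩
  · obtain ⟨hgR, μ, hμ, hl⟩ := hg
    obtain ⟨x, rfl⟩ := eq_of_of_length_eq_one hl
    rw [← h2 x g hgR hμ, map_sub, hincl, hρ, sub_self]
  · rw [← QuotAlg.mk_eq_mk]
    let p : Submodule k (Lbs k par) :=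
      LinearMap.eqLocus (QuotAlg.mk k R ∘ₗ
        (((Lbs.incl k par (restLetters deg R)).comp (Lbs.lift h4)) : Lbs k par →ₗ[k] Lbs k par))
        (QuotAlg.mk k R)
    have hof (a) : QuotAlg.mk k R (Lbs.incl k par _ (Lbs.lift h4 (Lbs.of k par a))) =
        QuotAlg.mk k R (Lbs.of k par a) := by
      rw [hρ]
      by_cases ha : a ∈ restLetters deg R
      · rw [h1 a ha, incl_of]
      · obtain ⟨g, hg, hga⟩ := h3 a ha
        rw [eq_comm, QuotAlg.mk_eq_mk, h2 a g hg hga]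
        exact subset_idealSpan k R hg
    have hp (z) : z ∈ p ↔ QuotAlg.mk k R (Lbs.incl k par _ (Lbs.lift h4 z)) = QuotAlg.mk k R z :=
      Iff.rfl
    refine (hp f).1 (nf_mem_induction hof (fun w a hw => ?_) f)
    rw [hp] at hw ⊢
    rw [map_mul, map_mul, QuotAlg.mk_mul, QuotAlg.mk_mul, hw, hof]

theorem length_isLeading_restRel {f : Lbs k (par ∘ ((↑) : restLetters deg R → X))}
    (hf : f ∈ restRel deg R) {μ : FreeSemigroup (restLetters deg R)}
    (hμ : IsLeading (deg ∘ ((↑) : restLetters deg R → X)) f μ) : 1 < μ.length := by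
  have h1 : μ.length ≠ 1 := fun h =>
    hf.2 ⟨hf.1, _, isLeading_incl_iff.2 hμ, by rw [length_mapWord, h]⟩
  have h2 : μ.length = μ.tail.length + 1 := rfl
  omega

/-- The inclusion carries normal polynomials and leading monomials over `X'` to those over `X`, so a
violation in `R'` would be one in `R`. -/
theorem restRel_reduced (hR : IsReducedGSBasis deg R)
    (s : Lbs k (par ∘ ((↑) : restLetters deg R → X))) (hs : s ∈ restRel deg R)
    (μ : FreeSemigroup (restLetters deg R)) (hμ : μ ∈ supp s) :
    μ ∈ Irr (deg ∘ ((↑) : restLetters deg R → X)) (restRel deg R \ {s}) := by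
  intro g hg p hp hpμ
  exact hR.reduced _ hs.1 _ (mapWord_mem_supp_incl.2 hμ) _
    ⟨hg.1.1, fun h => hg.2 (incl_injective h)⟩ _ hp.incl (isLeading_incl_iff.2 hpμ)

theorem trivialModDeg_map (hR : IsReducedGSBasis deg R)
    (ρ : Lbs k par →ₙₐ[k] Lbs k (par ∘ ((↑) : restLetters deg R → X)))
    (h1 : ∀ f, ρ (Lbs.incl k par _ f) = f) (h2 : ∀ g ∈ letterPart deg R, ρ g = 0)
    (h3 : ∀ x, ρ (Lbs.of k par x) ∈ Submodule.span k
        (Lbs.nf k _ '' {w | wordDeg (deg ∘ ((↑) : restLetters deg R → X)) w ≤ deg x}))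
    {n : ℕ} {f : Lbs k par} (hf : TrivialModDeg deg R n f) :
    TrivialModDeg (deg ∘ ((↑) : restLetters deg R → X)) (restRel deg R) n (ρ f) := by
  unfold TrivialModDeg at *
  induction hf using Submodule.span_induction with
  | zero => rw [map_zero]; exact zero_mem _
  | add a b _ _ h1 h2 => rw [map_add]; exact add_mem h1 h2
  | smul r a _ h => rw [map_smul]; exact Submodule.smul_mem _ _ h
  | mem p hp =>
    obtain ⟨s, hs, hp, ν, hν, hn⟩ := hp
    by_cases hsl : s ∈ letterPart deg R
    -- Every normal polynomial on `s` has `s` as a factor, and `ρ` kills `s`.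
    · have : ρ p = 0 := by
        cases hp with
        | right as => exact map_mulLetters_eq_zero ρ (h2 s hsl) as
        | mid μ as hx =>
          exact map_mulLetters_eq_zero ρ (by rw [map_mul, h2 s hsl, mul_zero]) as
      rw [this]
      exact zero_mem _
    · cases hp with
      | mid μ as hx =>
        obtain ⟨x, hx⟩ := hx
        exact absurd ⟨hs, _, hx, rfl⟩ hsl
      | right as =>
        obtain ⟨t, rfl⟩ := mem_range_incl hR ⟨hs, hsl⟩
        have htR : t ∈ restRel deg R := ⟨hs, hsl⟩
        have ht := (hR.monic _ hs).of_incl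
        obtain ⟨κ, hκ, _⟩ := id ht
        -- The leading monomial is `κ` followed by `as`, so the bound `n` controls `deg κ` plus the
        -- degree of `as`.
        have hν' := (isLeading_mulLetters (hR.monic _ hs) (isLeading_incl_iff.2 hκ) as).unique hν
        rw [← hν', wordDeg_appendList, wordDeg_mapWord] at hn
        refine Submodule.span_mono ?_ (map_mulLetters_mem_span ρ h3 _ as)
        rintro _ ⟨bs, hbs, rfl⟩
        rw [h1]
        refine ⟨t, htR, .right bs, _, isLeading_mulLetters ht hκ bs, ?_⟩
        rw [wordDeg_appendList]
        omega

end Reduced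

end

end LeibnizGS

open LeibnizGS in
theorem mainTheorem10 (k : Type v) [Field k] (X : Type u) [LinearOrder X] [WellFoundedLT X]
    (par : X → ZMod 2) (deg : X → ℕ) (hdeg : ∀ x, 0 < deg x)
    (R : Set (Lbs k par)) (hR : IsReducedGSBasis deg R) :
    -- the inclusion `X' ⊆ X` identifies `Lbs(X')` with a subalgebra of `Lbs(X)` containing `R ∖ S`
    Function.Injective (Lbs.incl k par (restLetters deg R)) ∧
    Lbs.incl k par (restLetters deg R) '' restRel deg R = R \ letterPart deg R ∧
    -- `Lbs(X | R) ≅ Lbs(X' | R')` as superalgebras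
    SuperIso k (Presented.grade k par R)
      (Presented.grade k (par ∘ ((↑) : restLetters deg R → X)) (restRel deg R)) ∧
    -- `R'` is a reduced Gröbner–Shirshov basis in `Lbs(X')`
    IsReducedGSBasis (deg ∘ ((↑) : restLetters deg R → X)) (restRel deg R) ∧
    -- the leading monomial of each element of `R'` has length greater than `1`
    (∀ f ∈ restRel deg R, ∀ μ,
      IsLeading (deg ∘ ((↑) : restLetters deg R → X)) f μ → 1 < μ.length) := by
  obtain ⟨ρ, h1, h2, h3, h4, h5⟩ := exists_retraction hR
  refine ⟨incl_injective, Set.image_preimage_eq_of_subset fun s hs => mem_range_incl hR hs, ?_, ?_,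
    fun f hf μ hμ => length_isLeading_restRel hf hμ⟩
  · refine superIso_of_inverse ρ (Lbs.incl k par (restLetters deg R)) (fun s hs => ?_)
      (fun t ht => subset_idealSpan k R ht.1) h3 (fun b => ?_) (Lbs.grade k par) (Lbs.grade k _)
      h4 (fun i b hb => incl_mem_grade hb)
    · by_cases hsl : s ∈ letterPart deg R
      · rw [h2 s hsl]
        exact zero_mem _
      · obtain ⟨t, rfl⟩ := mem_range_incl hR ⟨hs, hsl⟩
        rw [h1]
        exact subset_idealSpan k _ ⟨hs, hsl⟩
    · rw [h1, sub_self]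
      exact zero_mem _
  · refine ⟨⟨fun f hf => (hR.monic _ hf.1).of_incl, fun f hf => (hR.homogeneous _ hf.1).of_incl,
      fun f hf μ ν hν hl hne => ?_, fun f hf g hg hfg p hp ν hν hpν => ?_⟩, restRel_reduced hR⟩
    -- The composition over `X'` is also one over `X`; `ρ` fixes it and carries its expression over
    -- `R` to one over `R'`.
    · have h := hR.leftMul _ hf.1 (mapWord (↑) μ) _ (isLeading_incl_iff.2 hν)
        (by rwa [length_mapWord])
      rw [← incl_nf, ← map_mul, wordDeg_mapWord, wordDeg_mapWord] at h
      have h' := trivialModDeg_map hR ρ h1 h2 h5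
        (h ((map_ne_zero_iff _ incl_injective).2 hne))
      rwa [h1] at h'
    -- The leading monomial of `f` lies in its support, hence in `Irr(R' \ {f})`, so no such `h_g`
    -- exists.
    · exact absurd hpν (restRel_reduced hR f hf ν hν.1 g ⟨hg, Ne.symm hfg⟩ p hp)
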